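/- **Theorem (separation).** Let the variables be $x_1,\dots,x_n$. A clause is a set of literals on pairwise different variables, a CNF formula $\phi$ is a finite set of clauses, and its size $|\phi|$ is the number of its clauses. Unit clause propagation (UCP) on $\phi$ derives a literal $l$ whenever some clause $D\in\phi$ contains $l$ and the negations of all the literals in $D\setminus\{l\}$ have been derived, and it reaches the contradiction $\bot$ when the negations of all the literals of some clause of $\phi$ have been derived; $\mathrm{UCP}(\phi)$ is $\{\bot\}$ if the contradiction is reached, and the set of all derived literals otherwise. Formulas $\phi_1,\phi_2$ are *ucp-equivalent* if $\mathrm{UCP}(\phi_1\wedge\alpha)=\mathrm{UCP}(\phi_2\wedge\alpha)$ for every partial assignment $\alpha$ of the variables (understood as a conjunction of literals). A formula $\phi$ is *ucp-irredundant* if for no $D\in\phi$ the formulas $\phi$ and $\phi\setminus\{D\}$ are ucp-equivalent. For integers $n>r>k>0$, let $C(n,r,k)$ be the covering number, i.e. the smallest size of a system of $r$-subsets of an $n$-set such that every $k$-subset is contained in at least one set of the system. There are absolute constants $a,b,d,e>0$ such that for every real $c$ there is an $N$ such that for every $n\ge N$ and every integer $k$ with $|k-n/2|\le c$ there is a ucp-irredundant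 formula $\phi^\ell$ on $n$ variables of size $$|\phi^\ell|=(k+1)\binom{n-1}{k},\qquad a\,n\binom nk\le (k+1)\binom{n-1}{k}\le b\,n\binom nk ,$$ such that a smallest (in the number of clauses) formula $\phi^*$ on the same variables ucp-equivalent to $\phi^\ell$ has size $$|\phi^*|\le 6(k+1)\,C(n,k+1,k)\le d\,(\ln n)\binom nk ,$$ and, in particular, $$\frac{|\phi^\ell|}{|\phi^*|}\ge e\,\frac{n}{\ln n}.$$ That is, for $k=n/2+O(1)$, $|\phi^\ell|=\Theta(n)\binom nk$, $|\phi^*|=O(\ln n)\binom nk$ and $|\phi^\ell|/|\phi^*|=\Omega(n/\ln n)$. -/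

import Mathlib

namespace UCP

/-- A literal on a variable of `V`: `(x, true)` is the literal `x`, `(x, false)` is `¬x`. -/
abbrev Literal (V : Type*) := V × Bool

/-- The negation of a literal. -/
def Literal.neg {V : Type*} (l : Literal V) : Literal V := (l.1, !l.2)

/-- A clause: a finite set of literals on pairwise different variables. -/
abbrev Clause (V : Type*) :=
  {C : Finset (Literal V) // ∀ l ∈ C, ∀ m ∈ C, l.1 = m.1 → l = m}

/-- The unit clause consisting of the literal `l`. -/
def Clause.unit {V : Type*} (l : Literal V) : Clause V :=
  ⟨{l}, by
    intro a ha b hb _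
    rw [Finset.mem_singleton] at ha hb
    rw [ha, hb]⟩

/-- A CNF formula: a finite set of clauses. Its size is its cardinality. -/
abbrev Formula (V : Type*) := Finset (Clause V)

/-- A partial assignment of the variables (`none` means unassigned). -/
abbrev PartialAssignment (V : Type*) := V → Option Bool

/-- The formula `φ ∧ α`, where `α` is identified with the conjunction of the literals that it
makes true. -/
def Formula.withAssignment {V : Type*} [Fintype V] [DecidableEq V]
    (φ : Formula V) (α : PartialAssignment V) : Formula V :=
  φ ∪ ((Finset.univ : Finset (Literal V)).filter fun l => α l.1 = some l.2).image Clause.unit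

/-- `Derives φ l`: the literal `l` can be derived by unit clause propagation on `φ`. The literals
of the unit clauses of `φ` are the case where the last hypothesis is empty. -/
inductive Derives {V : Type*} (φ : Formula V) : Literal V → Prop
  | step (C : Clause V) (hC : C ∈ φ) (l : Literal V) (hl : l ∈ C.1)
      (h : ∀ m ∈ C.1, m ≠ l → Derives φ m.neg) : Derives φ l

/-- Unit clause propagation on `φ` reaches the contradiction: the negations of all the literals of
some clause are derived (this covers the case that `φ` contains the empty clause). -/
def DerivesBot {V : Type*} (φ : Formula V) : Prop :=
  ∃ C ∈ φ, ∀ m ∈ C.1, Derives φ m.neg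

open Classical in
/-- The result of unit clause propagation: `{⊥}` if the contradiction is reached, and the set of
the derived literals otherwise. -/
noncomputable def ucp {V : Type*} (φ : Formula V) : Set (WithBot (Literal V)) :=
  if DerivesBot φ then {⊥} else {u | ∃ l : Literal V, u = (l : WithBot (Literal V)) ∧ Derives φ l}

/-- Two formulas are ucp-equivalent if unit clause propagation gives the same result on both of
them together with any partial assignment. -/
def Equivalent {V : Type*} [Fintype V] [DecidableEq V] (φ ψ : Formula V) : Prop :=
  ∀ α : PartialAssignment V, ucp (φ.withAssignment α) = ucp (ψ.withAssignment α)

/-- A formula is ucp-irredundant if removing any clause leads to a formula that is not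
ucp-equivalent to it. -/
def Irredundant {V : Type*} [Fintype V] [DecidableEq V] (φ : Formula V) : Prop :=
  ∀ C ∈ φ, ¬ Equivalent φ (φ.erase C)

/-- `ψ` is a smallest formula (in the number of clauses) that is ucp-equivalent to `φ`. -/
def IsSmallestEquivalent {V : Type*} [Fintype V] [DecidableEq V] (φ ψ : Formula V) : Prop :=
  Equivalent φ ψ ∧ ∀ χ : Formula V, Equivalent φ χ → ψ.card ≤ χ.card

/-- `S` is a system of `r`-subsets of an `n`-set such that every `k`-subset is contained in at
least one set of the system. -/
def IsCovering (n r k : ℕ) (S : Finset (Finset (Fin n))) : Prop :=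
  (∀ B ∈ S, B.card = r) ∧ ∀ A : Finset (Fin n), A.card = k → ∃ B ∈ S, A ⊆ B

/-- The covering number `C(n, r, k)` (for `n > r > k > 0`): the smallest size of such a system. -/
noncomputable def coveringNumber (n r k : ℕ) : ℕ :=
  sInf {m | ∃ S : Finset (Finset (Fin n)), IsCovering n r k S ∧ S.card = m}

end UCP

/-!
All formulas below consist of definite Horn clauses `B \ {x} → x` with `|B| = k + 1` and `x ∈ B`.
For a `(k - 1)`-set `P`, the clauses `P ∪ {y} → x` are the arcs from `y` to `x` of a digraph on the
complement of `P`, the link of `P`. If all links are strongly connected, then unit propagation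
derives all variables from any `k` true ones, and it falsifies everything outside `P` as soon as
`P` is true and one further variable is false. So it simulates every clause of this shape, and any
two formulas with strongly connected links are ucp-equivalent (`LinkConnected.equivalent`).

The large formula `starClauses z k` takes all `B` containing a fixed variable `z`. In its links,
all arcs touch `z`, or all arcs are present if `z ∈ P`. Removing a clause with variable set `B` is
detected by the assignment that falsifies the literals of the clause on `B \ {z}` and leaves all
other variables unassigned (`irredundant_starClauses`).

For the small formula, let `S` be an optimal covering of the `k`-sets by `(k + 1)`-sets. Taking all
clauses with variable sets in `S` gives links that are undirected graphs without isolated vertices,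
but they need not be connected. Take the union of four randomly permuted copies of `S`. A graph
with `m` vertices, none of them isolated, has at most about `(m.choose s) ^ (1 / 2)` closed
`s`-sets (`card_closedSets_sq_le`), so a given `s`-set is closed in the link of `P` in all four
copies with probability about `(m.choose s) ^ (-2)`, up to a factor polynomial in `s`. A union
bound over the `s`-sets, for `2 ≤ s ≤ m / 2`, shows that the link of `P` is disconnected with
probability `O(m ^ (-2))`. Therefore some choice of the permutations leaves so few sets `P` with a
disconnected link that these links can be repaired one by one with at most `2 * n.choose k` extra
clauses (`exists_linkConnected_card_le`). Since `n.choose k ≤ (k + 1) * |S|`, the total is at most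
`6 * (k + 1) * |S|`. The greedy algorithm bounds `|S|` from above (`coveringNumber_le`).
-/

namespace UCP

/-! ### Horn formulas and their links -/

section Horn

variable {V : Type*} [DecidableEq V]

/-- The definite Horn clause `⋀ (B \ {x}) → x`, encoded by the set `B` of its variables and its
head `x`, which is meant to belong to `B`. -/
def hornClause (B : Finset V) (x : V) : Clause V :=
  ⟨B.image fun y => (y, decide (y = x)), by
    intro l hl m hm h
    obtain ⟨y, -, rfl⟩ := Finset.mem_image.1 hl
    obtain ⟨w, -, rfl⟩ := Finset.mem_image.1 hm
    obtain rfl : y = w := h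
    rfl⟩

lemma mem_hornClause {B : Finset V} {x : V} {m : Literal V} :
    m ∈ (hornClause B x).1 ↔ m.1 ∈ B ∧ m.2 = decide (m.1 = x) := by
  obtain ⟨v, b⟩ := m
  simp only [hornClause, Finset.mem_image, Prod.mk.injEq]
  constructor
  · rintro ⟨y, hy, rfl, rfl⟩
    exact ⟨hy, rfl⟩
  · rintro ⟨h, h'⟩
    exact ⟨v, h, rfl, h'.symm⟩

lemma hornClause_inj {B B' : Finset V} {x x' : V} (hx : x ∈ B)
    (h : hornClause B x = hornClause B' x') : B = B' ∧ x = x' := by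
  have key : ∀ m : Literal V, m ∈ (hornClause B x).1 ↔ m ∈ (hornClause B' x').1 := by
    rw [h]; exact fun _ => Iff.rfl
  simp only [mem_hornClause] at key
  refine ⟨?_, ?_⟩
  · ext y
    constructor
    · exact fun hy => ((key (y, decide (y = x))).1 ⟨hy, rfl⟩).1
    · exact fun hy => ((key (y, decide (y = x'))).2 ⟨hy, rfl⟩).1
  · have := ((key (x, true)).1 ⟨hx, by simp⟩).2
    simpa using this

/-- The formula consisting of the Horn clauses encoded by the pairs in `H`. -/
def hornFormula (H : Finset (Finset V × V)) : Formula V :=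
  H.image fun p => hornClause p.1 p.2

lemma mem_hornFormula {H : Finset (Finset V × V)} {C : Clause V} :
    C ∈ hornFormula H ↔ ∃ B x, (B, x) ∈ H ∧ hornClause B x = C := by
  simp [hornFormula]

lemma card_hornFormula {H : Finset (Finset V × V)} (hH : ∀ B x, (B, x) ∈ H → x ∈ B) :
    (hornFormula H).card = H.card := by
  refine Finset.card_image_of_injOn ?_
  rintro ⟨B, x⟩ h ⟨B', x'⟩ _ he
  obtain ⟨rfl, rfl⟩ := hornClause_inj (hH B x h) he
  rfl

/-- The link of a set `P` in `H` is the digraph on the complement of `P` with an arc from `y` to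
`x` whenever `H` contains the clause `P ∪ {y} → x`. The predicate says that all links of
`(k - 1)`-sets are strongly connected: no nonempty proper part `p` of the complement of `P` is
closed under the arcs of the link. -/
def LinkConnected (k : ℕ) (H : Finset (Finset V × V)) : Prop :=
  ∀ P : Finset V, P.card + 1 = k → ∀ p : V → Prop, (∃ y, y ∉ P ∧ p y) → (∃ x, x ∉ P ∧ ¬ p x) →
    ∃ y x, y ∉ P ∧ x ∉ P ∧ p y ∧ ¬ p x ∧ (insert x (insert y P), x) ∈ H

section Propagation

variable {k : ℕ} {H : Finset (Finset V × V)} {ψ : Formula V} {P : Finset V}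

lemma LinkConnected.derives_true (hH : LinkConnected k H) (hψ : hornFormula H ⊆ ψ)
    (hP : P.card + 1 = k) (hd : ∀ w ∈ P, Derives ψ (w, true)) {y : V} (hy : y ∉ P)
    (hyd : Derives ψ (y, true)) {w : V} (hw : w ∉ P) : Derives ψ (w, true) := by
  by_contra hwd
  obtain ⟨y, x, hyP, hxP, hy, hx, hm⟩ :=
    hH P hP (fun v => Derives ψ (v, true)) ⟨y, hy, hyd⟩ ⟨w, hw, hwd⟩
  refine hx (Derives.step _ (hψ (mem_hornFormula.2 ⟨_, _, hm, rfl⟩)) _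
    (mem_hornClause.2 ⟨by simp, by simp⟩) ?_)
  rintro ⟨v, b⟩ hv hne
  obtain ⟨hvB, hb⟩ := mem_hornClause.1 hv
  dsimp only at hvB
  have hvx : v ≠ x := by
    rintro rfl
    exact hne (Prod.ext rfl (hb.trans (decide_eq_true rfl)))
  obtain rfl : b = decide (v = x) := hb
  simp only [Literal.neg, hvx, decide_false, Bool.not_false]
  rcases Finset.mem_insert.1 hvB with h | h
  · exact absurd h hvx
  rcases Finset.mem_insert.1 h with rfl | h
  · exact hy
  · exact hd v h

lemma LinkConnected.derives_false (hH : LinkConnected k H) (hψ : hornFormula H ⊆ ψ)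
    (hP : P.card + 1 = k) (hd : ∀ w ∈ P, Derives ψ (w, true)) {x : V} (hx : x ∉ P)
    (hxd : Derives ψ (x, false)) {w : V} (hw : w ∉ P) : Derives ψ (w, false) := by
  by_contra hwd
  obtain ⟨y, x, hyP, hxP, hy, hx, hm⟩ :=
    hH P hP (fun v => ¬ Derives ψ (v, false)) ⟨w, hw, hwd⟩ ⟨x, hx, not_not.2 hxd⟩
  rw [not_not] at hx
  have hyx : y ≠ x := by rintro rfl; exact hy hx
  refine hy (Derives.step _ (hψ (mem_hornFormula.2 ⟨_, _, hm, rfl⟩)) _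
    (mem_hornClause.2 ⟨by simp, by simp [hyx]⟩) ?_)
  rintro ⟨v, b⟩ hv hne
  obtain ⟨hvB, hb⟩ := mem_hornClause.1 hv
  dsimp only at hvB
  obtain rfl : b = decide (v = x) := hb
  rcases Finset.mem_insert.1 hvB with rfl | h
  · simpa [Literal.neg] using hx
  rcases Finset.mem_insert.1 h with rfl | h
  · simp [hyx] at hne
  · have hvx : v ≠ x := by rintro rfl; exact hxP h
    simpa [Literal.neg, hvx] using hd v h

end Propagation

variable [Fintype V]

lemma mem_withAssignment {φ : Formula V} {α : PartialAssignment V} {C : Clause V} :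
    C ∈ φ.withAssignment α ↔ C ∈ φ ∨ ∃ l : Literal V, α l.1 = some l.2 ∧ Clause.unit l = C := by
  unfold Formula.withAssignment
  rw [Finset.mem_union, Finset.mem_image]
  simp

lemma subset_withAssignment (φ : Formula V) (α : PartialAssignment V) :
    φ ⊆ φ.withAssignment α :=
  fun _ h => mem_withAssignment.2 (Or.inl h)

lemma derives_of_assigned (φ : Formula V) {α : PartialAssignment V} {l : Literal V}
    (h : α l.1 = some l.2) : Derives (φ.withAssignment α) l :=
  Derives.step (Clause.unit l) (mem_withAssignment.2 (Or.inr ⟨l, h, rfl⟩)) l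
    (Finset.mem_singleton_self l) fun _ hm hne => absurd (Finset.mem_singleton.1 hm) hne

/-- Unit propagation on a formula with strongly connected links simulates every clause of the form
`A → x` with `|A| = k`. -/
lemma LinkConnected.derives_of_derives {k : ℕ} (hk : 0 < k) {H K : Finset (Finset V × V)}
    (hH : LinkConnected k H) (hK : ∀ B x, (B, x) ∈ K → B.card = k + 1 ∧ x ∈ B)
    {α : PartialAssignment V} {l : Literal V}
    (h : Derives ((hornFormula K).withAssignment α) l) :
    Derives ((hornFormula H).withAssignment α) l := by
  induction h with
  | step C hC l hl _ ih =>
    rcases mem_withAssignment.1 hC with hC | ⟨m, hm, rfl⟩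
    · obtain ⟨B, x, hBx, rfl⟩ := mem_hornFormula.1 hC
      obtain ⟨hcard, hx⟩ := hK B x hBx
      obtain ⟨w, b⟩ := l
      obtain ⟨hw, hb⟩ := mem_hornClause.1 hl
      dsimp only at hw
      obtain rfl : b = decide (w = x) := hb
      have hpos : ∀ v ∈ B, v ≠ x → v ≠ w →
          Derives ((hornFormula H).withAssignment α) (v, true) := by
        intro v hv hvx hvw
        simpa [Literal.neg, hvx] using ih (v, decide (v = x)) (mem_hornClause.2 ⟨hv, rfl⟩)
          (fun h => hvw (congrArg Prod.fst h))
      by_cases hwx : w = x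
      · subst hwx
        have hc : (B.erase w).card = k := by rw [Finset.card_erase_of_mem hw, hcard]; rfl
        obtain ⟨y, hy⟩ := Finset.card_pos.1 (hc ▸ hk)
        have hyB := Finset.mem_erase.1 hy
        rw [decide_eq_true rfl]
        refine hH.derives_true (subset_withAssignment _ _) (P := (B.erase w).erase y) ?_ ?_
          (Finset.notMem_erase y _) (hpos y hyB.2 hyB.1 hyB.1) ?_
        · rw [Finset.card_erase_add_one hy, hc]
        · intro v hv
          have hv := Finset.mem_erase.1 (Finset.mem_of_mem_erase hv)
          exact hpos v hv.2 hv.1 hv.1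
        · exact fun h => Finset.notMem_erase w B (Finset.mem_of_mem_erase h)
      · have hc : (B.erase x).card = k := by rw [Finset.card_erase_of_mem hx, hcard]; rfl
        have hwB : w ∈ B.erase x := Finset.mem_erase.2 ⟨hwx, hw⟩
        have hxd : Derives ((hornFormula H).withAssignment α) (x, false) := by
          simpa [Literal.neg] using ih (x, true) (mem_hornClause.2 ⟨hx, by simp⟩)
            (fun h => hwx (congrArg Prod.fst h).symm)
        rw [decide_eq_false hwx]
        refine hH.derives_false (subset_withAssignment _ _) (P := (B.erase x).erase w) ?_ ?_
          (x := x) ?_ hxd (Finset.notMem_erase w _)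
        · rw [Finset.card_erase_add_one hwB, hc]
        · intro v hv
          obtain ⟨h1, h2⟩ := Finset.mem_erase.1 hv
          obtain ⟨h2, h3⟩ := Finset.mem_erase.1 h2
          exact hpos v h3 h2 h1
        · exact fun h => Finset.notMem_erase x B (Finset.mem_of_mem_erase h)
    · obtain rfl := Finset.mem_singleton.1 hl
      exact derives_of_assigned _ hm

lemma LinkConnected.derivesBot_of_derivesBot {k : ℕ} (hk : 0 < k) {H K : Finset (Finset V × V)}
    (hH : LinkConnected k H) (hK : ∀ B x, (B, x) ∈ K → B.card = k + 1 ∧ x ∈ B)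
    {α : PartialAssignment V} (h : DerivesBot ((hornFormula K).withAssignment α)) :
    DerivesBot ((hornFormula H).withAssignment α) := by
  obtain ⟨C, hC, hd⟩ := h
  replace hd := fun m hm => hH.derives_of_derives hk hK (hd m hm)
  rcases mem_withAssignment.1 hC with hC | ⟨m, hm, rfl⟩
  · obtain ⟨B, x, hBx, rfl⟩ := mem_hornFormula.1 hC
    obtain ⟨hcard, hx⟩ := hK B x hBx
    have hc : (B.erase x).card = k := by rw [Finset.card_erase_of_mem hx, hcard]; rfl
    obtain ⟨y, hy⟩ := Finset.card_pos.1 (hc ▸ hk)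
    have hyB := Finset.mem_erase.1 hy
    have hpos : ∀ v ∈ B, v ≠ x → Derives ((hornFormula H).withAssignment α) (v, true) := by
      intro v hv hvx
      simpa [Literal.neg, hvx] using hd (v, decide (v = x)) (mem_hornClause.2 ⟨hv, rfl⟩)
    have hxd : Derives ((hornFormula H).withAssignment α) (x, false) := by
      simpa [Literal.neg] using hd (x, true) (mem_hornClause.2 ⟨hx, by simp⟩)
    have hP : ((B.erase x).erase y).card + 1 = k := by
      rw [Finset.card_erase_add_one hy, hc]
    have hPd : ∀ v ∈ (B.erase x).erase y,
        Derives ((hornFormula H).withAssignment α) (v, true) := by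
      intro v hv
      have hv := Finset.mem_erase.1 (Finset.mem_of_mem_erase hv)
      exact hpos v hv.2 hv.1
    have hxP : x ∉ (B.erase x).erase y :=
      fun h => Finset.notMem_erase x B (Finset.mem_of_mem_erase h)
    -- All variables are derived, so a clause of `H` with head `x` becomes violated.
    obtain ⟨y', x', hy'P, -, hy'x, hx', hm⟩ := hH _ hP (fun v => v ≠ x)
      ⟨y, Finset.notMem_erase y _, hyB.1⟩ ⟨x, hxP, not_not.2 rfl⟩
    rw [not_not] at hx'
    subst hx'
    refine ⟨_, subset_withAssignment _ _ (mem_hornFormula.2 ⟨_, _, hm, rfl⟩), ?_⟩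
    rintro ⟨v, b⟩ hv
    obtain ⟨hvB, hb⟩ := mem_hornClause.1 hv
    dsimp only at hvB
    obtain rfl : b = decide (v = x') := hb
    by_cases hvx : v = x'
    · subst hvx
      simpa [Literal.neg] using hxd
    · simp only [Literal.neg, hvx, decide_false, Bool.not_false]
      rcases Finset.mem_insert.1 hvB with h | h
      · exact absurd h hvx
      rcases Finset.mem_insert.1 h with rfl | h
      · exact hH.derives_true (subset_withAssignment _ _) hP hPd (Finset.notMem_erase y _)
          (hpos y hyB.2 hyB.1) hy'P
      · exact hPd v h
  · exact ⟨_, mem_withAssignment.2 (Or.inr ⟨m, hm, rfl⟩), hd⟩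

/-- Strong connectivity of the links determines the result of unit propagation. -/
lemma LinkConnected.equivalent {k : ℕ} (hk : 0 < k) {H K : Finset (Finset V × V)}
    (hH : LinkConnected k H) (hH' : ∀ B x, (B, x) ∈ H → B.card = k + 1 ∧ x ∈ B)
    (hK : LinkConnected k K) (hK' : ∀ B x, (B, x) ∈ K → B.card = k + 1 ∧ x ∈ B) :
    Equivalent (hornFormula H) (hornFormula K) := by
  intro α
  have h1 : ∀ l, Derives ((hornFormula H).withAssignment α) l ↔
      Derives ((hornFormula K).withAssignment α) l :=
    fun l => ⟨hK.derives_of_derives hk hH', hH.derives_of_derives hk hK'⟩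
  have h2 : DerivesBot ((hornFormula H).withAssignment α) ↔
      DerivesBot ((hornFormula K).withAssignment α) :=
    ⟨hK.derivesBot_of_derivesBot hk hH', hH.derivesBot_of_derivesBot hk hK'⟩
  unfold ucp
  simp only [h1]
  by_cases h : DerivesBot ((hornFormula H).withAssignment α)
  · rw [if_pos h, if_pos (h2.1 h)]
  · rw [if_neg h, if_neg (fun h' => h (h2.2 h'))]

/-- If unit propagation on `ψ ∧ α` is stuck at `α`, while `φ ∧ α` derives a literal outside `α`,
then `φ` and `ψ` are not ucp-equivalent. -/
lemma not_equivalent_of_stuck {φ ψ : Formula V} (α : PartialAssignment V)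
    (hne : ∀ C ∈ ψ, C.1.Nonempty)
    (hstuck : ∀ C ∈ ψ, ∀ l ∈ C.1, (∀ m ∈ C.1, m ≠ l → α m.1 = some !m.2) → α l.1 = some l.2)
    {l : Literal V} (hl : α l.1 ≠ some l.2) (hd : Derives (φ.withAssignment α) l) :
    ¬ Equivalent φ ψ := by
  have hsound : ∀ m, Derives (ψ.withAssignment α) m → α m.1 = some m.2 := by
    intro m hm
    induction hm with
    | step C hC m hm _ ih =>
      rcases mem_withAssignment.1 hC with hC | ⟨m', hm', rfl⟩
      · exact hstuck C hC m hm ih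
      · rwa [Finset.mem_singleton.1 hm]
  have hbot : ¬ DerivesBot (ψ.withAssignment α) := by
    rintro ⟨C, hC, hC'⟩
    have hC'' : ∀ m ∈ C.1, α m.1 = some !m.2 := fun m hm => hsound _ (hC' m hm)
    rcases mem_withAssignment.1 hC with hC | ⟨m, hm, rfl⟩
    · obtain ⟨m, hm⟩ := hne C hC
      have h1 := hstuck C hC m hm fun m' hm' _ => hC'' m' hm'
      simp [hC'' m hm] at h1
    · have h1 := hC'' m (Finset.mem_singleton_self m)
      simp [hm] at h1
  intro h
  have h := h α
  rw [ucp, ucp, if_neg hbot] at h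
  split_ifs at h with hb
  · have : (⊥ : WithBot (Literal V)) ∈ ({⊥} : Set (WithBot (Literal V))) := rfl
    rw [h] at this
    obtain ⟨m, hm, -⟩ := this
    exact WithBot.bot_ne_coe hm
  · have : (l : WithBot (Literal V)) ∈
        {u | ∃ l : Literal V, u = (l : WithBot (Literal V)) ∧ Derives (φ.withAssignment α) l} :=
      ⟨l, rfl, hd⟩
    rw [h] at this
    obtain ⟨m, hm, hm'⟩ := this
    obtain rfl := WithBot.coe_injective hm
    exact hl (hsound _ hm')

/-! ### The star formula -/

/-- The clauses `B \ {x} → x` for all `(k + 1)`-sets `B` containing the fixed variable `z` and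
all `x ∈ B`. -/
def starClauses (z : V) (k : ℕ) : Finset (Finset V × V) :=
  Finset.univ.filter fun p => p.1.card = k + 1 ∧ z ∈ p.1 ∧ p.2 ∈ p.1

lemma mem_starClauses {z : V} {k : ℕ} {B : Finset V} {x : V} :
    (B, x) ∈ starClauses z k ↔ B.card = k + 1 ∧ z ∈ B ∧ x ∈ B := by
  simp [starClauses]

lemma linkConnected_starClauses (z : V) (k : ℕ) : LinkConnected k (starClauses z k) := by
  rintro P hP p ⟨u, huP, hu⟩ ⟨v, hvP, hv⟩
  have hcard : ∀ y x, y ∉ P → x ∉ P → p y → ¬ p x →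
      (insert x (insert y P)).card = k + 1 := by
    intro y x hy hx hpy hpx
    have hxy : x ≠ y := by rintro rfl; exact hpx hpy
    rw [Finset.card_insert_of_notMem (by simp [hx, hxy]), Finset.card_insert_of_notMem hy, hP]
  by_cases hzP : z ∈ P
  · exact ⟨u, v, huP, hvP, hu, hv, mem_starClauses.2 ⟨hcard u v huP hvP hu hv, by simp [hzP],
      by simp⟩⟩
  by_cases hz : p z
  · exact ⟨z, v, hzP, hvP, hz, hv, mem_starClauses.2 ⟨hcard z v hzP hvP hz hv, by simp, by simp⟩⟩
  · exact ⟨u, z, huP, hzP, hu, hz, mem_starClauses.2 ⟨hcard u z huP hzP hu hz, by simp, by simp⟩⟩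

/-- The clause `B \ {x} → x` is not redundant: after its removal, the assignment that satisfies no
literal of the clause and leaves only `z` unassigned among the variables in `B` does not
propagate. -/
lemma irredundant_starClauses (z : V) (k : ℕ) : Irredundant (hornFormula (starClauses z k)) := by
  intro C hC
  obtain ⟨B, x, hBx, rfl⟩ := mem_hornFormula.1 hC
  obtain ⟨hcard, hz, hx⟩ := mem_starClauses.1 hBx
  refine not_equivalent_of_stuck
    (fun y => if y ∈ B.erase z then some !(decide (y = x)) else none) ?_ ?_
    (l := (z, decide (z = x))) (by simp) ?_
  · intro C' hC'
    obtain ⟨B', x', hBx', rfl⟩ := mem_hornFormula.1 (Finset.mem_of_mem_erase hC')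
    exact ⟨(x', true), mem_hornClause.2 ⟨(mem_starClauses.1 hBx').2.2, by simp⟩⟩
  · intro C' hC' l hl hm
    obtain ⟨hne, hC'⟩ := Finset.mem_erase.1 hC'
    obtain ⟨B', x', hBx', rfl⟩ := mem_hornFormula.1 hC'
    obtain ⟨hcard', hz', hx'⟩ := mem_starClauses.1 hBx'
    exfalso
    have hlz : l.1 = z := by
      by_contra hlz
      have := hm (z, decide (z = x')) (mem_hornClause.2 ⟨hz', rfl⟩)
        (fun h => hlz (congrArg Prod.fst h).symm)
      simp at this
    have hval : ∀ y ∈ B', y ≠ z → y ∈ B ∧ (y = x ↔ y = x') := by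
      intro y hy hyz
      have := hm (y, decide (y = x')) (mem_hornClause.2 ⟨hy, rfl⟩)
        (fun h => hyz (by rw [← hlz, ← h]))
      dsimp only at this
      split_ifs at this with h
      refine ⟨Finset.mem_of_mem_erase h, ?_⟩
      simpa using this
    have hsub : B' ⊆ B := by
      intro y hy
      by_cases hyz : y = z
      · rwa [hyz]
      · exact (hval y hy hyz).1
    obtain rfl : B' = B := Finset.eq_of_subset_of_card_le hsub (by omega)
    apply hne
    have hxx : x = x' := by
      by_cases hxz : x = z
      · by_cases hxz' : x' = z
        · rw [hxz, hxz']
        · exact ((hval x' hx' hxz').2.2 rfl).symm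
      · exact (hval x hx hxz).2.1 rfl
    rw [hxx]
  · refine Derives.step _ (subset_withAssignment _ _ hC) _ (mem_hornClause.2 ⟨hz, rfl⟩) ?_
    rintro ⟨y, b⟩ hy hne
    obtain ⟨hyB, hb⟩ := mem_hornClause.1 hy
    dsimp only at hyB
    have hyz : y ≠ z := by
      rintro rfl
      exact hne (Prod.ext rfl hb)
    refine derives_of_assigned _ ?_
    simp only [Literal.neg, Finset.mem_erase, ne_eq, hyz, not_false_eq_true, hyB, and_self,
      if_true]
    exact congrArg (fun c => some !c) hb.symm

lemma card_starClauses (z : V) (k : ℕ) :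
    (starClauses z k).card = (k + 1) * (Fintype.card V - 1).choose k := by
  have h1 : ((Finset.powersetCard k (Finset.univ.erase z)).image (insert z)).card =
      (Fintype.card V - 1).choose k := by
    rw [Finset.card_image_of_injOn, Finset.card_powersetCard,
      Finset.card_erase_of_mem (Finset.mem_univ z), Finset.card_univ]
    intro A hA A' hA' h
    have hzA : ∀ A ∈ Finset.powersetCard k (Finset.univ.erase z), z ∉ A := fun A hA hz =>
      Finset.notMem_erase z _ ((Finset.mem_powersetCard.1 hA).1 hz)
    rw [← Finset.erase_insert (hzA A hA), ← Finset.erase_insert (hzA A' hA')]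
    exact congrArg (fun B => Finset.erase B z) h
  have h2 : starClauses z k =
      (((Finset.powersetCard k (Finset.univ.erase z)).image (insert z)).sigma
        fun B => B).map (Equiv.sigmaEquivProd _ _).toEmbedding := by
    ext ⟨B, x⟩
    simp only [mem_starClauses, Finset.mem_map_equiv, Finset.mem_sigma, Finset.mem_image,
      Finset.mem_powersetCard]
    change _ ↔ _ ∧ x ∈ B
    constructor
    · rintro ⟨hc, hz, hx⟩
      exact ⟨⟨B.erase z, ⟨Finset.erase_subset_erase z (Finset.subset_univ B),
        by rw [Finset.card_erase_of_mem hz, hc]; rfl⟩, Finset.insert_erase hz⟩, hx⟩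
    · rintro ⟨⟨A, ⟨hA, hc⟩, rfl⟩, hx⟩
      have hz : z ∉ A := fun h => Finset.notMem_erase z _ (hA h)
      exact ⟨by rw [Finset.card_insert_of_notMem hz, hc], Finset.mem_insert_self z A, hx⟩
  rw [h2, Finset.card_map, Finset.card_sigma, Finset.sum_const_nat (m := k + 1), h1, mul_comm]
  intro B hB
  obtain ⟨A, hA, rfl⟩ := Finset.mem_image.1 hB
  obtain ⟨hA, hc⟩ := Finset.mem_powersetCard.1 hA
  rw [Finset.card_insert_of_notMem fun h => Finset.notMem_erase z _ (hA h), hc]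

end Horn

/-! ### Closed sets of a graph without isolated vertices -/

section ClosedSets

variable {V : Type*} [DecidableEq V]

/-- A graph without isolated vertices has a set of vertices such that both it and its complement
are dominating, namely a largest independent set. -/
lemma exists_dominating_split (W : Finset V) (R : V → V → Prop) (hR : ∀ x y, R x y → R y x)
    (hW : ∀ x ∈ W, ∃ y ∈ W, y ≠ x ∧ R x y) :
    ∃ L ⊆ W, (∀ x ∈ W, x ∉ L → ∃ y ∈ L, R x y) ∧ ∀ x ∈ L, ∃ y ∈ W, y ∉ L ∧ R x y := by
  classical
  let Ind : Finset V → Prop := fun L => ∀ x ∈ L, ∀ y ∈ L, x ≠ y → ¬ R x y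
  obtain ⟨L, hL, hmax⟩ := Finset.exists_max_image (W.powerset.filter Ind) Finset.card
    ⟨∅, Finset.mem_filter.2 ⟨Finset.empty_mem_powerset W, by simp [Ind]⟩⟩
  obtain ⟨hLW, hind⟩ := Finset.mem_filter.1 hL
  rw [Finset.mem_powerset] at hLW
  refine ⟨L, hLW, ?_, ?_⟩
  · intro x hx hxL
    by_contra! hno
    have := hmax (insert x L) (Finset.mem_filter.2 ⟨Finset.mem_powerset.2
      (Finset.insert_subset hx hLW), ?_⟩)
    · rw [Finset.card_insert_of_notMem hxL] at this
      omega
    · intro a ha b hb hab hRab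
      rcases Finset.mem_insert.1 ha with rfl | ha <;> rcases Finset.mem_insert.1 hb with rfl | hb
      · exact hab rfl
      · exact hno b hb hRab
      · exact hno a (by assumption) (hR _ _ hRab)
      · exact hind a ha b hb hab hRab
  · intro x hx
    obtain ⟨y, hy, hyx, hxy⟩ := hW x (hLW hx)
    exact ⟨y, hy, fun hyL => hind x hx y hyL hyx.symm hxy, hxy⟩

open Classical in
/-- The `s`-subsets of `W` that are closed under the relation `R` on `W`. -/
noncomputable def closedSets (W : Finset V) (R : V → V → Prop) (s : ℕ) : Finset (Finset V) :=
  (Finset.powersetCard s W).filter fun U => ∀ x ∈ U, ∀ y ∈ W, R x y → y ∈ U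

lemma mem_closedSets {W : Finset V} {R : V → V → Prop} {s : ℕ} {U : Finset V} :
    U ∈ closedSets W R s ↔ (U ⊆ W ∧ U.card = s) ∧ ∀ x ∈ U, ∀ y ∈ W, R x y → y ∈ U := by
  simp [closedSets, Finset.mem_powersetCard]

lemma choose_le_choose_of_le_half {m s t : ℕ} (hts : t ≤ s) (hs : 2 * s ≤ m) :
    m.choose t ≤ m.choose s := by
  induction s, hts using Nat.le_induction with
  | base => exact le_rfl
  | succ s _ ih =>
    exact (ih (by omega)).trans (Nat.choose_le_succ_of_lt_half_left (by omega))

/-- A graph with `m` vertices, none of them isolated, has roughly at most the square root of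
`m.choose s` closed `s`-sets. With `L` as in `exists_dominating_split`, a closed set is determined
by its part in `L`, and also by its part outside `L`. So a pair `(U₁, U₂)` of closed sets is
determined by `(U₁ ∩ L) ∪ (U₂ \ L)`. This set or the one for `(U₂, U₁)` has at most `s` elements. -/
lemma card_closedSets_sq_le {W : Finset V} {R : V → V → Prop} (hR : ∀ x y, R x y → R y x)
    (hW : ∀ x ∈ W, ∃ y ∈ W, y ≠ x ∧ R x y) {s : ℕ} (hs : 2 * s ≤ W.card) :
    (closedSets W R s).card ^ 2 ≤ 2 * ((s + 1) * W.card.choose s) := by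
  obtain ⟨L, hLW, hout, hin⟩ := exists_dominating_split W R hR hW
  set 𝒞 := closedSets W R s with h𝒞
  let f : Finset V × Finset V → Finset V := fun p => (p.1 ∩ L) ∪ (p.2 \ L)
  have hdetL : ∀ U ∈ 𝒞, ∀ U' ∈ 𝒞, U ∩ L = U' ∩ L → U ⊆ U' := by
    intro U hU U' hU' h x hx
    obtain ⟨⟨hUW, -⟩, hU⟩ := mem_closedSets.1 hU
    obtain ⟨-, hU'⟩ := mem_closedSets.1 hU'
    by_cases hxL : x ∈ L
    · exact (Finset.mem_inter.1 (h ▸ Finset.mem_inter.2 ⟨hx, hxL⟩)).1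
    · obtain ⟨y, hy, hxy⟩ := hout x (hUW hx) hxL
      have hyU := hU x hx y (hLW hy) hxy
      have hyU' : y ∈ U' := (Finset.mem_inter.1 (h ▸ Finset.mem_inter.2 ⟨hyU, hy⟩)).1
      exact hU' y hyU' x (hUW hx) (hR _ _ hxy)
  have hdetR : ∀ U ∈ 𝒞, ∀ U' ∈ 𝒞, U \ L = U' \ L → U ⊆ U' := by
    intro U hU U' hU' h x hx
    obtain ⟨⟨hUW, -⟩, hU⟩ := mem_closedSets.1 hU
    obtain ⟨-, hU'⟩ := mem_closedSets.1 hU'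
    by_cases hxL : x ∈ L
    · obtain ⟨y, hy, hyL, hxy⟩ := hin x hxL
      have hyU := hU x hx y hy hxy
      have hyU' : y ∈ U' := (Finset.mem_sdiff.1 (h ▸ Finset.mem_sdiff.2 ⟨hyU, hyL⟩)).1
      exact hU' y hyU' x (hUW hx) (hR _ _ hxy)
    · exact (Finset.mem_sdiff.1 (h ▸ Finset.mem_sdiff.2 ⟨hx, hxL⟩)).1
  have hinj : Set.InjOn f (𝒞 ×ˢ 𝒞 : Finset (Finset V × Finset V)) := by
    rintro ⟨U₁, U₂⟩ hU ⟨U₁', U₂'⟩ hU' h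
    obtain ⟨h1, h2⟩ := Finset.mem_product.1 hU
    obtain ⟨h1', h2'⟩ := Finset.mem_product.1 hU'
    have hL : U₁ ∩ L = U₁' ∩ L := by
      have := congrArg (· ∩ L) h
      simpa [f, Finset.union_inter_distrib_right, Finset.inter_assoc] using this
    have hR : U₂ \ L = U₂' \ L := by
      have := congrArg (· \ L) h
      simpa [f, Finset.union_sdiff_distrib, Finset.inter_sdiff_assoc] using this
    exact Prod.ext
      (Finset.Subset.antisymm (hdetL _ h1 _ h1' hL) (hdetL _ h1' _ h1 hL.symm))
      (Finset.Subset.antisymm (hdetR _ h2 _ h2' hR) (hdetR _ h2' _ h2 hR.symm))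
  let Q := (𝒞 ×ˢ 𝒞).filter fun p => (f p).card ≤ s
  have hQ : Q.card ≤ (s + 1) * W.card.choose s := by
    calc Q.card ≤ ((Finset.range (s + 1)).biUnion fun t => Finset.powersetCard t W).card := by
          refine Finset.card_le_card_of_injOn f ?_
            (hinj.mono fun p hp => (Finset.mem_filter.1 hp).1)
          intro p hp
          obtain ⟨hp, hps⟩ := Finset.mem_filter.1 hp
          obtain ⟨h1, h2⟩ := Finset.mem_product.1 hp
          refine Finset.mem_biUnion.2 ⟨_, Finset.mem_range.2 (Nat.lt_succ_of_le hps),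
            Finset.mem_powersetCard.2 ⟨Finset.union_subset ?_ ?_, rfl⟩⟩
          · exact Finset.inter_subset_left.trans (mem_closedSets.1 h1).1.1
          · exact Finset.sdiff_subset.trans (mem_closedSets.1 h2).1.1
      _ ≤ ∑ t ∈ Finset.range (s + 1), W.card.choose t := by
          refine Finset.card_biUnion_le.trans (le_of_eq ?_)
          simp [Finset.card_powersetCard]
      _ ≤ ∑ _t ∈ Finset.range (s + 1), W.card.choose s :=
          Finset.sum_le_sum fun t ht =>
            choose_le_choose_of_le_half (Nat.lt_succ_iff.1 (Finset.mem_range.1 ht)) hs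
      _ = (s + 1) * W.card.choose s := by simp
  have hcover : 𝒞 ×ˢ 𝒞 ⊆ Q ∪ Q.image Prod.swap := by
    rintro ⟨U₁, U₂⟩ hU
    obtain ⟨h1, h2⟩ := Finset.mem_product.1 hU
    by_cases h : (f (U₁, U₂)).card ≤ s
    · exact Finset.mem_union_left _ (Finset.mem_filter.2 ⟨hU, h⟩)
    · refine Finset.mem_union_right _ (Finset.mem_image.2 ⟨(U₂, U₁), Finset.mem_filter.2
        ⟨Finset.mem_product.2 ⟨h2, h1⟩, ?_⟩, rfl⟩)
      have c1 : U₁.card = s := (mem_closedSets.1 h1).1.2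
      have c2 : U₂.card = s := (mem_closedSets.1 h2).1.2
      have e1 := Finset.card_inter_add_card_sdiff U₁ L
      have e2 := Finset.card_inter_add_card_sdiff U₂ L
      have u1 : (f (U₁, U₂)).card ≤ (U₁ ∩ L).card + (U₂ \ L).card := Finset.card_union_le _ _
      have u2 : (f (U₂, U₁)).card ≤ (U₂ ∩ L).card + (U₁ \ L).card := Finset.card_union_le _ _
      omega
  calc 𝒞.card ^ 2 = (𝒞 ×ˢ 𝒞).card := by rw [Finset.card_product, sq]
    _ ≤ (Q ∪ Q.image Prod.swap).card := Finset.card_le_card hcover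
    _ ≤ Q.card + Q.card := (Finset.card_union_le _ _).trans (by
        exact Nat.add_le_add_left Finset.card_image_le _)
    _ ≤ 2 * ((s + 1) * W.card.choose s) := by omega

end ClosedSets

/-! ### Random permutations of a set system -/

section Permutations

open Equiv (Perm)

variable {V : Type*} [Fintype V] [DecidableEq V]

/-- The adjacency of the link graph of `P` in the set system `S`: the vertices are the elements
outside `P`, and `x`, `y` are joined if `P ∪ {x, y}` belongs to `S`. -/
def LinkRel (S : Finset (Finset V)) (P : Finset V) (x y : V) : Prop :=
  insert x (insert y P) ∈ S

omit [Fintype V] in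
lemma linkRel_symm {S : Finset (Finset V)} {P : Finset V} {x y : V} (h : LinkRel S P x y) :
    LinkRel S P y x := by
  unfold LinkRel at *
  rwa [Finset.insert_comm]

open Classical in
/-- The permutations that move `U` to a closed set of the link graph of the image of `P`. In other
words, `U` is closed in the link graph of `P` in the preimage of `S` under the permutation. -/
noncomputable def closingPerms (S : Finset (Finset V)) (P U : Finset V) : Finset (Perm V) :=
  Finset.univ.filter fun σ => U.map σ.toEmbedding ∈
    closedSets (P.map σ.toEmbedding)ᶜ (LinkRel S (P.map σ.toEmbedding)) U.card

lemma mem_closingPerms' {S : Finset (Finset V)} {P U : Finset V} {σ : Perm V} :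
    σ ∈ closingPerms S P U ↔ U.map σ.toEmbedding ∈
      closedSets (P.map σ.toEmbedding)ᶜ (LinkRel S (P.map σ.toEmbedding)) U.card := by
  simp [closingPerms]

lemma mem_closingPerms {S : Finset (Finset V)} {P U : Finset V} {σ : Perm V} (hU : U ⊆ Pᶜ) :
    σ ∈ closingPerms S P U ↔ ∀ x ∈ U, ∀ y, y ∉ P →
      (insert x (insert y P)).map σ.toEmbedding ∈ S → y ∈ U := by
  rw [mem_closingPerms', mem_closedSets]
  have hU' : U.map σ.toEmbedding ⊆ (P.map σ.toEmbedding)ᶜ := by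
    intro v hv
    obtain ⟨u, hu, rfl⟩ := Finset.mem_map.1 hv
    simpa using Finset.mem_compl.1 (hU hu)
  simp only [hU', Finset.card_map, true_and]
  constructor
  · intro h x hx y hy hxy
    have := h (σ x) (Finset.mem_map_of_mem _ hx) (σ y) (by simpa using hy)
      (by simpa [LinkRel, Finset.map_insert] using hxy)
    simpa using this
  · intro h v hv w hw hvw
    obtain ⟨x, hx, rfl⟩ := Finset.mem_map.1 hv
    obtain ⟨y, rfl⟩ := σ.surjective w
    have := h x hx y (by simpa using hw)
      (by simpa [LinkRel, Finset.map_insert] using hvw)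
    simpa using this

/-- Sets of the same size outside `P` are related by a permutation that preserves `P`. -/
lemma exists_perm_map_eq {P U U' : Finset V} (hU : U ⊆ Pᶜ) (hU' : U' ⊆ Pᶜ)
    (h : U.card = U'.card) :
    ∃ τ : Perm V, P.map τ.toEmbedding = P ∧ U.map τ.toEmbedding = U' := by
  classical
  have hd : Disjoint P U := Finset.disjoint_left.2 fun x hx hxU =>
    Finset.mem_compl.1 (hU hxU) hx
  let e : U ≃ U' := Finset.equivOfCardEq h
  let f : {x // x ∈ P ∪ U} → V := fun x => if hx : x.1 ∈ U then e ⟨x.1, hx⟩ else x.1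
  have hf : Function.Injective f := by
    rintro ⟨x, hx⟩ ⟨y, hy⟩ hxy
    simp only [f] at hxy
    have key : ∀ z (hz : z ∈ U) w, w ∈ P → ((e ⟨z, hz⟩ : {x // x ∈ U'}) : V) ≠ w := by
      rintro z hz w hw rfl
      exact Finset.mem_compl.1 (hU' (e ⟨z, hz⟩).2) hw
    split_ifs at hxy with h1 h2 h2
    · have := e.injective (Subtype.ext hxy)
      simpa using this
    · exact absurd hxy (key x h1 y ((Finset.mem_union.1 hy).resolve_right h2))
    · exact absurd hxy.symm (key y h2 x ((Finset.mem_union.1 hx).resolve_right h1))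
    · exact Subtype.ext hxy
  let E := Equiv.ofInjective f hf
  let τ : Perm V := Equiv.extendSubtype (p := fun x => x ∈ P ∪ U)
    (q := fun x => x ∈ Set.range f) E
  have hτ : ∀ x (hx : x ∈ P ∪ U), τ x = f ⟨x, hx⟩ := fun x hx =>
    Equiv.extendSubtype_apply_of_mem E x hx
  refine ⟨τ, ?_, ?_⟩
  · refine Finset.eq_of_subset_of_card_le ?_ (by simp)
    intro v hv
    obtain ⟨x, hx, rfl⟩ := Finset.mem_map.1 hv
    have hxU : x ∉ U := Finset.disjoint_left.1 hd hx
    rw [Equiv.coe_toEmbedding, hτ x (Finset.mem_union_left _ hx)]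
    simpa [f, hxU] using hx
  · refine Finset.eq_of_subset_of_card_le ?_ (by simp [h])
    intro v hv
    obtain ⟨x, hx, rfl⟩ := Finset.mem_map.1 hv
    rw [Equiv.coe_toEmbedding, hτ x (Finset.mem_union_right _ hx)]
    simp [f, hx]

lemma card_closingPerms_le (S : Finset (Finset V)) {P U U' : Finset V} (hU : U ⊆ Pᶜ)
    (hU' : U' ⊆ Pᶜ) (h : U.card = U'.card) :
    (closingPerms S P U).card ≤ (closingPerms S P U').card := by
  obtain ⟨τ, hP, hτ⟩ := exists_perm_map_eq hU' hU h.symm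
  refine Finset.card_le_card_of_injOn (fun σ => σ * τ) ?_
    (fun σ _ σ' _ hσ => mul_right_cancel hσ)
  intro σ hσ
  rw [Finset.mem_coe, mem_closingPerms'] at hσ
  have hmul : ∀ A : Finset V, A.map (σ * τ).toEmbedding =
      (A.map τ.toEmbedding).map σ.toEmbedding := by
    intro A
    rw [Finset.map_map]
    rfl
  rw [Finset.mem_coe, mem_closingPerms', hmul, hmul, hP, hτ, ← h]
  exact hσ

/-- The link graphs of `(k - 1)`-sets in `S` have no isolated vertices. For a system of
`(k + 1)`-sets, this means that every `k`-set is covered. -/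
def NoIsolated (k : ℕ) (S : Finset (Finset V)) : Prop :=
  ∀ P : Finset V, P.card + 1 = k → ∀ x, x ∉ P → ∃ y, y ∉ P ∧ y ≠ x ∧ LinkRel S P x y

/-- A set `U` outside a `(k - 1)`-set `P` is closed under a random permutation of `S` with
probability at most about `(m.choose s) ^ (-1 / 2)`, where `m = |Pᶜ|` and `s = |U|`. By symmetry,
the probability is the average over all `s`-sets outside `P` and over all permutations, so it is
bounded by the maximal proportion of closed `s`-sets in a link graph. -/
lemma card_closingPerms_sq_le {k : ℕ} {S : Finset (Finset V)} (hS : NoIsolated k S)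
    {P U : Finset V} (hP : P.card + 1 = k) (hU : U ⊆ Pᶜ) (hs : 2 * U.card ≤ Pᶜ.card) :
    ((closingPerms S P U).card : ℝ) ^ 2 * (Pᶜ.card.choose U.card) ≤
      ((Fintype.card V).factorial : ℝ) ^ 2 * (2 * (U.card + 1)) := by
  classical
  set s := U.card with hsdef
  set C := Pᶜ.card.choose s with hC
  set q := (closingPerms S P U).card with hq
  let N : Perm V → ℕ := fun σ =>
    (closedSets (P.map σ.toEmbedding)ᶜ (LinkRel S (P.map σ.toEmbedding)) s).card
  have hcardc : ∀ σ : Perm V, (P.map σ.toEmbedding)ᶜ.card = Pᶜ.card := by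
    intro σ
    rw [Finset.card_compl, Finset.card_compl, Finset.card_map]
  have hN : ∀ σ, N σ ^ 2 ≤ 2 * ((s + 1) * C) := by
    intro σ
    have := card_closedSets_sq_le (W := (P.map σ.toEmbedding)ᶜ)
      (R := LinkRel S (P.map σ.toEmbedding)) (fun _ _ => linkRel_symm) (s := s) ?_
      (by rw [hcardc]; exact hs)
    · rwa [hcardc] at this
    · intro x hx
      obtain ⟨y, hy, hyx, hxy⟩ := hS (P.map σ.toEmbedding) (by rw [Finset.card_map, hP]) x
        (Finset.mem_compl.1 hx)
      exact ⟨y, Finset.mem_compl.2 hy, hyx, hxy⟩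
  have hqC : q * C ≤ ∑ σ : Perm V, N σ := by
    calc q * C = ∑ _U' ∈ Finset.powersetCard s Pᶜ, q := by
          rw [Finset.sum_const, Finset.card_powersetCard, smul_eq_mul, mul_comm]
      _ ≤ ∑ U' ∈ Finset.powersetCard s Pᶜ, (closingPerms S P U').card := by
          refine Finset.sum_le_sum fun U' hU' => ?_
          obtain ⟨h1, h2⟩ := Finset.mem_powersetCard.1 hU'
          exact card_closingPerms_le S hU h1 h2.symm
      _ = ∑ σ : Perm V,
          ((Finset.powersetCard s Pᶜ).filter fun U' => σ ∈ closingPerms S P U').card := by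
          simp only [Finset.card_filter, Finset.card_eq_sum_ones (closingPerms S P _)]
          rw [Finset.sum_comm]
          refine Finset.sum_congr rfl fun U' _ => ?_
          rw [← Finset.sum_filter]
          simp
      _ ≤ ∑ σ : Perm V, N σ := by
          refine Finset.sum_le_sum fun σ _ => ?_
          refine Finset.card_le_card_of_injOn (fun U' => U'.map σ.toEmbedding) ?_
            (fun _ _ _ _ h => Finset.map_injective _ h)
          intro U' hU'
          obtain ⟨h1, h2⟩ := Finset.mem_filter.1 hU'
          have := mem_closingPerms'.1 h2
          rwa [(Finset.mem_powersetCard.1 h1).2] at this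
  have hCpos : (0 : ℝ) < C := by
    have : 0 < C := Nat.choose_pos (by omega)
    exact_mod_cast this
  have hsum : ((q : ℝ) * C) ^ 2 ≤
      ((Fintype.card V).factorial : ℝ) ^ 2 * (2 * (s + 1)) * C := by
    calc ((q : ℝ) * C) ^ 2 ≤ (∑ σ : Perm V, (N σ : ℝ)) ^ 2 := by
          have : (q : ℝ) * C ≤ ∑ σ : Perm V, (N σ : ℝ) := by exact_mod_cast hqC
          exact pow_le_pow_left₀ (by positivity) this 2
      _ ≤ ((Finset.univ : Finset (Perm V)).card : ℝ) * ∑ σ : Perm V, (N σ : ℝ) ^ 2 :=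
          sq_sum_le_card_mul_sum_sq
      _ ≤ ((Finset.univ : Finset (Perm V)).card : ℝ) *
          ∑ _σ : Perm V, (2 * ((s + 1) * C) : ℝ) := by
          gcongr with σ
          exact_mod_cast hN σ
      _ = ((Fintype.card V).factorial : ℝ) ^ 2 * (2 * (s + 1)) * C := by
          rw [Finset.sum_const, Finset.card_univ, Fintype.card_perm, nsmul_eq_mul]
          ring
  have : ((q : ℝ) ^ 2 * C) * C ≤ ((Fintype.card V).factorial : ℝ) ^ 2 * (2 * (s + 1)) * C := by
    calc ((q : ℝ) ^ 2 * C) * C = ((q : ℝ) * C) ^ 2 := by ring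
      _ ≤ _ := hsum
  exact le_of_mul_le_mul_right this hCpos

/-- The set `P` is defective for the permutations `σ i` if the union of the link graphs of `P` in
the preimages of `S` is disconnected, as witnessed by a closed set of at least two and at most
half of the vertices. -/
def Defective {ι : Type*} (S : Finset (Finset V)) (σ : ι → Perm V) (P : Finset V) : Prop :=
  ∃ U ⊆ Pᶜ, 2 ≤ U.card ∧ 2 * U.card ≤ Pᶜ.card ∧ ∀ i, σ i ∈ closingPerms S P U

open Classical in
lemma card_defective_le {k : ℕ} {S : Finset (Finset V)} (hS : NoIsolated k S)
    {P : Finset V} (hP : P.card + 1 = k) :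
    ((Finset.univ.filter fun σ : Fin 4 → Perm V => Defective S σ P).card : ℝ) ≤
      ((Fintype.card V).factorial : ℝ) ^ 4 *
        ∑ s ∈ Finset.Icc 2 (Pᶜ.card / 2), 4 * ((s : ℝ) + 1) ^ 2 / (Pᶜ.card.choose s) := by
  set m := Pᶜ.card with hm
  set F := ((Fintype.card V).factorial : ℝ) with hF
  have h1 : (Finset.univ.filter fun σ : Fin 4 → Perm V => Defective S σ P) ⊆
      (Finset.Icc 2 (m / 2)).biUnion fun s => (Finset.powersetCard s Pᶜ).biUnion fun U =>
        Fintype.piFinset fun _ => closingPerms S P U := by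
    intro σ hσ
    obtain ⟨U, hU, h2, hm2, hc⟩ := (Finset.mem_filter.1 hσ).2
    refine Finset.mem_biUnion.2 ⟨U.card, Finset.mem_Icc.2 ⟨h2, by omega⟩,
      Finset.mem_biUnion.2 ⟨U, Finset.mem_powersetCard.2 ⟨hU, rfl⟩,
        Fintype.mem_piFinset.2 hc⟩⟩
  have h2 : (Finset.univ.filter fun σ : Fin 4 → Perm V => Defective S σ P).card ≤
      ∑ s ∈ Finset.Icc 2 (m / 2), ∑ U ∈ Finset.powersetCard s Pᶜ,
        (closingPerms S P U).card ^ 4 := by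
    refine (Finset.card_le_card h1).trans (Finset.card_biUnion_le.trans ?_)
    refine Finset.sum_le_sum fun s _ => Finset.card_biUnion_le.trans ?_
    simp [Fintype.card_piFinset]
  calc ((Finset.univ.filter fun σ : Fin 4 → Perm V => Defective S σ P).card : ℝ)
      ≤ ∑ s ∈ Finset.Icc 2 (m / 2), ∑ U ∈ Finset.powersetCard s Pᶜ,
        ((closingPerms S P U).card : ℝ) ^ 4 := by exact_mod_cast h2
    _ ≤ ∑ s ∈ Finset.Icc 2 (m / 2), F ^ 4 * (4 * ((s : ℝ) + 1) ^ 2 / (m.choose s)) := by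
        refine Finset.sum_le_sum fun s hs => ?_
        obtain ⟨hs2, hsm⟩ := Finset.mem_Icc.1 hs
        have hC : (0 : ℝ) < m.choose s := by
          have : 0 < m.choose s := Nat.choose_pos (by omega)
          exact_mod_cast this
        calc ∑ U ∈ Finset.powersetCard s Pᶜ, ((closingPerms S P U).card : ℝ) ^ 4
            ≤ ∑ _U ∈ Finset.powersetCard s Pᶜ,
              (F ^ 2 * (2 * (s + 1)) / (m.choose s)) ^ 2 := by
              refine Finset.sum_le_sum fun U hU => ?_
              obtain ⟨hU, hUs⟩ := Finset.mem_powersetCard.1 hU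
              have := card_closingPerms_sq_le hS hP hU (by omega)
              rw [hUs, ← hm, ← hF, ← le_div_iff₀ hC] at this
              calc ((closingPerms S P U).card : ℝ) ^ 4
                  = (((closingPerms S P U).card : ℝ) ^ 2) ^ 2 := by ring
                _ ≤ _ := pow_le_pow_left₀ (by positivity) this 2
          _ = F ^ 4 * (4 * ((s : ℝ) + 1) ^ 2 / (m.choose s)) := by
              rw [Finset.sum_const, Finset.card_powersetCard, nsmul_eq_mul, ← hm]
              field_simp
              ring
    _ = _ := by rw [Finset.mul_sum]

lemma sum_inv_choose_le {m : ℕ} (hm : 10 ≤ m) :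
    ∑ s ∈ Finset.Icc 2 (m / 2), 4 * ((s : ℝ) + 1) ^ 2 / (m.choose s) ≤ 20000 / (m : ℝ) ^ 2 := by
  have hm' : (10 : ℝ) ≤ m := by exact_mod_cast hm
  have hm0 : (0 : ℝ) < m := by linarith
  have hchoose : ∀ r : ℕ, r ≤ 5 → ((m : ℝ) / 2) ^ r / r.factorial ≤ m.choose r := by
    intro r hr
    refine le_trans ?_ (Nat.pow_le_choose r m)
    have : (m : ℝ) / 2 ≤ ((m + 1 - r : ℕ) : ℝ) := by
      rw [div_le_iff₀ two_pos]
      have : m ≤ (m + 1 - r) * 2 := by omega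
      exact_mod_cast this
    gcongr
  -- The terms with `s ≤ 4` are `O(m ^ (-2))`. Each of the others is `O(m ^ (-3))`, by comparison
  -- with `m.choose 5`, which is enough for a sum of at most `m` of them.
  have hterm : ∀ s ∈ Finset.Icc 2 (m / 2), 4 * ((s : ℝ) + 1) ^ 2 / (m.choose s) ≤
      (if s ≤ 4 then 800 / (m : ℝ) ^ 2 else 0) + 15360 / (m : ℝ) ^ 3 := by
    intro s hs
    obtain ⟨hs2, hsm⟩ := Finset.mem_Icc.1 hs
    split_ifs with h4
    · have h1 : (m : ℝ) ^ 2 / 8 ≤ m.choose s := by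
        have h2 := hchoose 2 (by norm_num)
        have h3 : (m.choose 2 : ℝ) ≤ m.choose s := by
          exact_mod_cast choose_le_choose_of_le_half hs2 (by omega)
        refine le_trans (le_of_eq ?_) (h2.trans h3)
        norm_num [Nat.factorial]
        ring
      have h5 : (s : ℝ) ≤ 4 := by exact_mod_cast h4
      calc 4 * ((s : ℝ) + 1) ^ 2 / (m.choose s) ≤ 4 * (4 + 1) ^ 2 / ((m : ℝ) ^ 2 / 8) := by
            gcongr
        _ = 800 / (m : ℝ) ^ 2 := by field_simp; norm_num
        _ ≤ _ := le_add_of_nonneg_right (by positivity)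
    · have h1 : (m : ℝ) ^ 5 / 3840 ≤ m.choose s := by
        have h2 := hchoose 5 le_rfl
        have h3 : (m.choose 5 : ℝ) ≤ m.choose s := by
          exact_mod_cast choose_le_choose_of_le_half (by omega) (by omega)
        refine le_trans (le_of_eq ?_) (h2.trans h3)
        norm_num [Nat.factorial]
        ring
      have h5 : (s : ℝ) + 1 ≤ m := by
        have : s + 1 ≤ m := by omega
        exact_mod_cast this
      calc 4 * ((s : ℝ) + 1) ^ 2 / (m.choose s) ≤ 4 * (m : ℝ) ^ 2 / ((m : ℝ) ^ 5 / 3840) := by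
            gcongr
        _ = 0 + 15360 / (m : ℝ) ^ 3 := by field_simp; norm_num
  calc ∑ s ∈ Finset.Icc 2 (m / 2), 4 * ((s : ℝ) + 1) ^ 2 / (m.choose s)
      ≤ ∑ s ∈ Finset.Icc 2 (m / 2),
        ((if s ≤ 4 then 800 / (m : ℝ) ^ 2 else 0) + 15360 / (m : ℝ) ^ 3) :=
        Finset.sum_le_sum hterm
    _ ≤ 5 * (800 / (m : ℝ) ^ 2) + m * (15360 / (m : ℝ) ^ 3) := by
        rw [Finset.sum_add_distrib, Finset.sum_const, nsmul_eq_mul, ← Finset.sum_filter,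
          Finset.sum_const, nsmul_eq_mul]
        have c1 : (((Finset.Icc 2 (m / 2)).filter fun s => s ≤ 4).card : ℝ) ≤ 5 := by
          have : ((Finset.Icc 2 (m / 2)).filter fun s => s ≤ 4) ⊆ Finset.range 5 := by
            intro s hs
            have := (Finset.mem_filter.1 hs).2
            exact Finset.mem_range.2 (by omega)
          have := Finset.card_le_card this
          rw [Finset.card_range] at this
          exact_mod_cast this
        have c2 : ((Finset.Icc 2 (m / 2)).card : ℝ) ≤ m := by
          rw [Nat.card_Icc]
          have : m / 2 + 1 - 2 ≤ m := by omega
          exact_mod_cast this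
        gcongr
    _ = 19360 / (m : ℝ) ^ 2 := by field_simp; norm_num
    _ ≤ 20000 / (m : ℝ) ^ 2 := by gcongr; norm_num

open Classical in
/-- Some four permutations leave at most a proportion of `O(m ^ (-2))` of the `j`-sets defective,
where `m` is the number of elements outside a `j`-set. -/
lemma exists_perms_card_defective_le {j : ℕ} {S : Finset (Finset V)} (hS : NoIsolated (j + 1) S)
    (hm : 10 ≤ Fintype.card V - j) :
    ∃ σ : Fin 4 → Perm V,
      (((Finset.powersetCard j Finset.univ).filter fun P => Defective S σ P).card : ℝ) ≤
        (Fintype.card V).choose j * (20000 / ((Fintype.card V - j : ℕ) : ℝ) ^ 2) := by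
  set m := Fintype.card V - j with hmdef
  set F := ((Fintype.card V).factorial : ℝ) with hF
  by_contra! hno
  have hcard : ((Finset.univ : Finset (Fin 4 → Perm V)).card : ℝ) = F ^ 4 := by
    simp [Fintype.card_perm, hF]
  have h1 : F ^ 4 * ((Fintype.card V).choose j * (20000 / (m : ℝ) ^ 2)) <
      ∑ σ : Fin 4 → Perm V,
        (((Finset.powersetCard j Finset.univ).filter fun P => Defective S σ P).card : ℝ) := by
    rw [← hcard, ← nsmul_eq_mul, ← Finset.sum_const]
    exact Finset.sum_lt_sum_of_nonempty ⟨1, Finset.mem_univ _⟩ fun σ _ => hno σ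
  refine absurd h1 (not_lt.2 ?_)
  calc ∑ σ : Fin 4 → Perm V,
        (((Finset.powersetCard j Finset.univ).filter fun P => Defective S σ P).card : ℝ)
      = ∑ P ∈ Finset.powersetCard j (Finset.univ : Finset V),
        ((Finset.univ.filter fun σ : Fin 4 → Perm V => Defective S σ P).card : ℝ) := by
        simp only [Finset.card_filter, Nat.cast_sum]
        exact Finset.sum_comm
    _ ≤ ∑ _P ∈ Finset.powersetCard j (Finset.univ : Finset V), F ^ 4 * (20000 / (m : ℝ) ^ 2) := by
        refine Finset.sum_le_sum fun P hP => ?_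
        have hPj := (Finset.mem_powersetCard.1 hP).2
        have hPc : Pᶜ.card = m := by rw [Finset.card_compl, hPj]
        refine (card_defective_le hS (by rw [hPj])).trans ?_
        rw [hPc]
        gcongr
        exact sum_inv_choose_le hm
    _ = F ^ 4 * ((Fintype.card V).choose j * (20000 / (m : ℝ) ^ 2)) := by
        rw [Finset.sum_const, Finset.card_powersetCard, Finset.card_univ, nsmul_eq_mul]
        ring

end Permutations

/-! ### Bounds on the covering number -/

section Covering

variable {n k : ℕ}

lemma IsCovering.coveringNumber_le {r : ℕ} {S : Finset (Finset (Fin n))}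
    (hS : IsCovering n r k S) : coveringNumber n r k ≤ S.card :=
  Nat.sInf_le ⟨S, hS, rfl⟩

lemma exists_superset_card_succ (hk : k < n) {A : Finset (Fin n)} (hA : A.card = k) :
    ∃ B : Finset (Fin n), B.card = k + 1 ∧ A ⊆ B := by
  obtain ⟨x, hx⟩ := Finset.card_pos.1
    (show 0 < Aᶜ.card by rw [Finset.card_compl, Fintype.card_fin, hA]; omega)
  exact ⟨insert x A, by rw [Finset.card_insert_of_notMem (Finset.mem_compl.1 hx), hA],
    Finset.subset_insert x A⟩

lemma exists_isCovering_card_eq (hk : k < n) :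
    ∃ S, IsCovering n (k + 1) k S ∧ S.card = coveringNumber n (k + 1) k := by
  refine Nat.sInf_mem (s := {m | ∃ S, IsCovering n (k + 1) k S ∧ S.card = m})
    ⟨_, Finset.powersetCard (k + 1) Finset.univ, ⟨?_, ?_⟩, rfl⟩
  · exact fun B hB => (Finset.mem_powersetCard.1 hB).2
  · intro A hA
    obtain ⟨B, hB, hAB⟩ := exists_superset_card_succ hk hA
    exact ⟨B, Finset.mem_powersetCard.2 ⟨Finset.subset_univ B, hB⟩, hAB⟩

lemma IsCovering.choose_le {S : Finset (Finset (Fin n))} (hS : IsCovering n (k + 1) k S) :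
    n.choose k ≤ (k + 1) * S.card := by
  have h : Finset.powersetCard k (Finset.univ : Finset (Fin n)) ⊆
      S.biUnion fun B => Finset.powersetCard k B := by
    intro A hA
    obtain ⟨B, hB, hAB⟩ := hS.2 A (Finset.mem_powersetCard.1 hA).2
    exact Finset.mem_biUnion.2 ⟨B, hB, Finset.mem_powersetCard.2
      ⟨hAB, (Finset.mem_powersetCard.1 hA).2⟩⟩
  calc n.choose k = (Finset.powersetCard k (Finset.univ : Finset (Fin n))).card := by
        rw [Finset.card_powersetCard, Finset.card_univ, Fintype.card_fin]
    _ ≤ ∑ B ∈ S, (Finset.powersetCard k B).card :=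
        (Finset.card_le_card h).trans Finset.card_biUnion_le
    _ = (k + 1) * S.card := by
        rw [Finset.sum_const_nat (m := k + 1), mul_comm]
        intro B hB
        rw [Finset.card_powersetCard, hS.1 B hB, Nat.choose_succ_self_right]

lemma IsCovering.noIsolated {S : Finset (Finset (Fin n))} (hS : IsCovering n (k + 1) k S) :
    NoIsolated k S := by
  intro P hP x hx
  have hA : (insert x P).card = k := by rw [Finset.card_insert_of_notMem hx, hP]
  obtain ⟨B, hB, hAB⟩ := hS.2 _ hA
  obtain ⟨y, hy⟩ := Finset.card_eq_one.1
    (show (B \ insert x P).card = 1 by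
      rw [Finset.card_sdiff_of_subset hAB, hS.1 B hB, hA]
      omega)
  have hyB : y ∈ B \ insert x P := hy ▸ Finset.mem_singleton_self y
  have hyx := (Finset.mem_sdiff.1 hyB).2
  rw [Finset.mem_insert, not_or] at hyx
  refine ⟨y, hyx.2, hyx.1, ?_⟩
  have hB' : insert y (insert x P) = B := by
    rw [Finset.insert_eq, ← hy, Finset.sdiff_union_of_subset hAB]
  unfold LinkRel
  rwa [Finset.insert_comm, hB']

/-- The `k`-sets that are not contained in a member of `S`. -/
def uncovered (k : ℕ) (S : Finset (Finset (Fin n))) : Finset (Finset (Fin n)) :=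
  (Finset.powersetCard k Finset.univ).filter fun A => ∀ B ∈ S, ¬ A ⊆ B

/-- One step of the greedy algorithm: some `(k + 1)`-set contains at least the average number of
the given `k`-sets. -/
lemma exists_average_le_card_subsets (hk : k < n) (𝒰 : Finset (Finset (Fin n)))
    (h𝒰 : ∀ A ∈ 𝒰, A.card = k) :
    ∃ B : Finset (Fin n), B.card = k + 1 ∧
      𝒰.card * (k + 1) ≤ (𝒰.filter fun A => A ⊆ B).card * n.choose k := by
  have hne : (Finset.powersetCard (k + 1) (Finset.univ : Finset (Fin n))).Nonempty := by
    rw [Finset.powersetCard_nonempty, Finset.card_univ, Fintype.card_fin]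
    exact hk
  have hdeg : ∀ A ∈ 𝒰, n - k ≤
      ((Finset.powersetCard (k + 1) (Finset.univ : Finset (Fin n))).filter
        fun B => A ⊆ B).card := by
    intro A hA
    calc n - k = Aᶜ.card := by rw [Finset.card_compl, Fintype.card_fin, h𝒰 A hA]
      _ ≤ _ := by
        refine Finset.card_le_card_of_injOn (fun x => insert x A) ?_ ?_
        · intro x hx
          have hx := Finset.mem_compl.1 hx
          exact Finset.mem_filter.2 ⟨Finset.mem_powersetCard.2 ⟨Finset.subset_univ _,
            by rw [Finset.card_insert_of_notMem hx, h𝒰 A hA]⟩, Finset.subset_insert x A⟩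
        · intro x hx y hy hxy
          have hxy : insert x A = insert y A := hxy
          have : x ∈ insert y A := hxy ▸ Finset.mem_insert_self x A
          exact (Finset.mem_insert.1 this).resolve_right (Finset.mem_compl.1 hx)
  have hsum : 𝒰.card * (n - k) ≤
      ∑ B ∈ Finset.powersetCard (k + 1) (Finset.univ : Finset (Fin n)),
        (𝒰.filter fun A => A ⊆ B).card := by
    calc 𝒰.card * (n - k) = ∑ _A ∈ 𝒰, (n - k) := by rw [Finset.sum_const, smul_eq_mul]
      _ ≤ ∑ A ∈ 𝒰, ((Finset.powersetCard (k + 1) (Finset.univ : Finset (Fin n))).filter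
          fun B => A ⊆ B).card := Finset.sum_le_sum hdeg
      _ = _ := by
          simp only [Finset.card_filter]
          exact Finset.sum_comm
  by_contra! hno
  have hlt : ∑ B ∈ Finset.powersetCard (k + 1) (Finset.univ : Finset (Fin n)),
        (𝒰.filter fun A => A ⊆ B).card * n.choose k <
      ∑ _B ∈ Finset.powersetCard (k + 1) (Finset.univ : Finset (Fin n)), 𝒰.card * (k + 1) :=
    Finset.sum_lt_sum_of_nonempty hne fun B hB => hno B (Finset.mem_powersetCard.1 hB).2
  rw [← Finset.sum_mul, Finset.sum_const, Finset.card_powersetCard, Finset.card_univ,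
    Fintype.card_fin, smul_eq_mul] at hlt
  have h1 := Nat.mul_le_mul_right (n.choose k) hsum
  have h2 : n.choose (k + 1) * (𝒰.card * (k + 1)) = 𝒰.card * (n - k) * n.choose k := by
    calc n.choose (k + 1) * (𝒰.card * (k + 1)) = 𝒰.card * (n.choose (k + 1) * (k + 1)) := by ring
      _ = 𝒰.card * (n - k) * n.choose k := by rw [Nat.choose_succ_right_eq]; ring
  omega

/-- Each step of the greedy algorithm covers at least a proportion `(k + 1) / n.choose k` of the
`k`-sets that are still uncovered. -/
lemma exists_greedy_system (hk : k < n) (t : ℕ) :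
    ∃ S : Finset (Finset (Fin n)), (∀ B ∈ S, B.card = k + 1) ∧ S.card ≤ t ∧
      ((uncovered k S).card : ℝ) ≤
        n.choose k * Real.exp (-((k + 1) / n.choose k) * t) := by
  induction t with
  | zero =>
    refine ⟨∅, by simp, by simp, ?_⟩
    simp [uncovered]
  | succ t ih =>
    obtain ⟨S, hS, hSt, hu⟩ := ih
    obtain ⟨B, hB, hBu⟩ := exists_average_le_card_subsets hk (uncovered k S)
      fun A hA => (Finset.mem_powersetCard.1 (Finset.mem_filter.1 hA).1).2
    refine ⟨insert B S, ?_, (Finset.card_insert_le B S).trans (by omega), ?_⟩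
    · intro B' hB'
      rcases Finset.mem_insert.1 hB' with rfl | h
      · exact hB
      · exact hS _ h
    have hC : (0 : ℝ) < n.choose k := by
      have : 0 < n.choose k := Nat.choose_pos hk.le
      exact_mod_cast this
    have hsplit : (uncovered k (insert B S)).card +
        ((uncovered k S).filter fun A => A ⊆ B).card ≤ (uncovered k S).card := by
      rw [← Finset.card_filter_add_card_filter_not (s := uncovered k S) (fun A => A ⊆ B), add_comm]
      refine Nat.add_le_add_left (Finset.card_le_card ?_) _
      intro A hA
      obtain ⟨h1, h2⟩ := Finset.mem_filter.1 hA
      exact Finset.mem_filter.2 ⟨Finset.mem_filter.2 ⟨h1, fun B' hB' =>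
        h2 B' (Finset.mem_insert_of_mem hB')⟩, h2 B (Finset.mem_insert_self B S)⟩
    have h1 : ((uncovered k S).card : ℝ) * ((k + 1) / n.choose k) ≤
        ((uncovered k S).filter fun A => A ⊆ B).card := by
      rw [← mul_div_assoc, div_le_iff₀ hC]
      exact_mod_cast hBu
    have h2 : ((uncovered k (insert B S)).card : ℝ) +
        ((uncovered k S).filter fun A => A ⊆ B).card ≤ (uncovered k S).card := by
      exact_mod_cast hsplit
    calc ((uncovered k (insert B S)).card : ℝ)
        ≤ (uncovered k S).card * (1 - (k + 1) / n.choose k) := by linarith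
      _ ≤ (uncovered k S).card * Real.exp (-((k + 1) / n.choose k)) := by
          gcongr
          exact Real.one_sub_le_exp_neg _
      _ ≤ n.choose k * Real.exp (-((k + 1) / n.choose k) * t) *
          Real.exp (-((k + 1) / n.choose k)) := by gcongr
      _ = n.choose k * Real.exp (-((k + 1) / n.choose k) * (t + 1 : ℕ)) := by
          rw [mul_assoc, ← Real.exp_add]
          push_cast
          ring_nf

/-- The Erdős–Spencer bound for `r = k + 1`. The greedy algorithm is run until at most a
`1 / (k + 1)` fraction of the `k`-sets is left, and these are covered one by one. -/
lemma coveringNumber_le (hk : k < n) :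
    ((k : ℝ) + 1) * coveringNumber n (k + 1) k ≤
      n.choose k * Real.log (k + 1) + (k + 1) + n.choose k := by
  have hC : (0 : ℝ) < n.choose k := by
    have : 0 < n.choose k := Nat.choose_pos hk.le
    exact_mod_cast this
  have hk1 : (0 : ℝ) < (k : ℝ) + 1 := by positivity
  have hlog : 0 ≤ Real.log ((k : ℝ) + 1) :=
    Real.log_nonneg (by linarith [Nat.cast_nonneg (α := ℝ) k])
  set t := ⌈n.choose k * Real.log (k + 1) / ((k : ℝ) + 1)⌉₊ with ht
  obtain ⟨S, hS, hSt, hu⟩ := exists_greedy_system hk t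
  have hext : ∀ A : Finset (Fin n), ∃ B : Finset (Fin n), A.card = k → B.card = k + 1 ∧ A ⊆ B := by
    intro A
    by_cases hA : A.card = k
    · obtain ⟨B, hB⟩ := exists_superset_card_succ hk hA
      exact ⟨B, fun _ => hB⟩
    · exact ⟨∅, fun h => absurd h hA⟩
  choose g hg using hext
  have hcov : IsCovering n (k + 1) k (S ∪ (uncovered k S).image g) := by
    constructor
    · intro B hB
      rcases Finset.mem_union.1 hB with h | h
      · exact hS B h
      · obtain ⟨A, hA, rfl⟩ := Finset.mem_image.1 h
        exact (hg A (Finset.mem_powersetCard.1 (Finset.mem_filter.1 hA).1).2).1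
    · intro A hA
      by_cases h : ∃ B ∈ S, A ⊆ B
      · obtain ⟨B, hB, hAB⟩ := h
        exact ⟨B, Finset.mem_union_left _ hB, hAB⟩
      · push Not at h
        exact ⟨g A, Finset.mem_union_right _ (Finset.mem_image_of_mem g (Finset.mem_filter.2
          ⟨Finset.mem_powersetCard.2 ⟨Finset.subset_univ A, hA⟩, h⟩)), (hg A hA).2⟩
  have h1 : (coveringNumber n (k + 1) k : ℝ) ≤ t + (uncovered k S).card := by
    have : coveringNumber n (k + 1) k ≤ t + (uncovered k S).card :=
      hcov.coveringNumber_le.trans ((Finset.card_union_le _ _).trans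
        (Nat.add_le_add hSt Finset.card_image_le))
    exact_mod_cast this
  have ht1 : (t : ℝ) ≤ n.choose k * Real.log (k + 1) / ((k : ℝ) + 1) + 1 :=
    (Nat.ceil_lt_add_one (by positivity)).le
  have ht2 : n.choose k * Real.log (k + 1) / ((k : ℝ) + 1) ≤ t := Nat.le_ceil _
  have h2 : ((uncovered k S).card : ℝ) ≤ n.choose k / (k + 1) := by
    refine hu.trans ?_
    rw [div_eq_mul_inv (n.choose k : ℝ) ((k : ℝ) + 1)]
    refine mul_le_mul_of_nonneg_left ?_ hC.le
    rw [← Real.exp_log (inv_pos.2 hk1), Real.log_inv]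
    refine Real.exp_le_exp.2 ?_
    rw [neg_mul]
    refine neg_le_neg ?_
    rw [div_le_iff₀ hk1] at ht2
    rw [div_mul_eq_mul_div, le_div_iff₀ hC]
    linarith
  calc ((k : ℝ) + 1) * coveringNumber n (k + 1) k
      ≤ (k + 1) * (n.choose k * Real.log (k + 1) / ((k : ℝ) + 1) + 1 + n.choose k / (k + 1)) := by
        gcongr
        linarith
    _ = _ := by field_simp

end Covering

/-! ### The small formula -/

section SmallFormula

open Equiv (Perm)

variable {V : Type*} [Fintype V] [DecidableEq V]

/-- All Horn clauses whose variable sets belong to one of the preimages of the set system `S` under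
the permutations `σ i`. -/
def permutedClauses {ι : Type*} [Fintype ι] (S : Finset (Finset V)) (σ : ι → Perm V) :
    Finset (Finset V × V) :=
  Finset.univ.filter fun p => p.2 ∈ p.1 ∧ ∃ i, p.1.map (σ i).toEmbedding ∈ S

lemma mem_permutedClauses {ι : Type*} [Fintype ι] {S : Finset (Finset V)} {σ : ι → Perm V}
    {B : Finset V} {x : V} :
    (B, x) ∈ permutedClauses S σ ↔ x ∈ B ∧ ∃ i, B.map (σ i).toEmbedding ∈ S := by
  simp [permutedClauses]

lemma card_permutedClauses_le {ι : Type*} [Fintype ι] {k : ℕ} {S : Finset (Finset V)}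
    (hS : ∀ B ∈ S, B.card = k + 1) (σ : ι → Perm V) :
    (permutedClauses S σ).card ≤ Fintype.card ι * ((k + 1) * S.card) := by
  have hsub : permutedClauses S σ ⊆ Finset.univ.biUnion fun i => S.biUnion fun B =>
      B.image fun x => (B.map (σ i).symm.toEmbedding, (σ i).symm x) := by
    rintro ⟨B, x⟩ h
    obtain ⟨hx, i, hi⟩ := mem_permutedClauses.1 h
    refine Finset.mem_biUnion.2 ⟨i, Finset.mem_univ i, Finset.mem_biUnion.2 ⟨_, hi,
      Finset.mem_image.2 ⟨σ i x, Finset.mem_map_of_mem _ hx, Prod.ext ?_ (by simp)⟩⟩⟩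
    ext y
    simp
  calc (permutedClauses S σ).card
      ≤ ∑ i : ι, ∑ B ∈ S, (B.image fun x => (B.map (σ i).symm.toEmbedding, (σ i).symm x)).card :=
        (Finset.card_le_card hsub).trans (Finset.card_biUnion_le.trans
          (Finset.sum_le_sum fun i _ => Finset.card_biUnion_le))
    _ ≤ ∑ _i : ι, ∑ _B ∈ S, (k + 1) := Finset.sum_le_sum fun i _ => Finset.sum_le_sum fun B hB =>
        Finset.card_image_le.trans (hS B hB).le
    _ = Fintype.card ι * ((k + 1) * S.card) := by
        simp [mul_comm]

/-- Clauses that make the link of `P` strongly connected: all arcs to and from the vertex `r`. -/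
def repairClauses (r : V) (P : Finset V) : Finset (Finset V × V) :=
  (Pᶜ.erase r).image (fun x => (insert x (insert r P), x)) ∪
    (Pᶜ.erase r).image (fun x => (insert x (insert r P), r))

lemma card_repairClauses_le (r : V) (P : Finset V) :
    (repairClauses r P).card ≤ 2 * Pᶜ.card := by
  have h := Finset.card_le_card (Finset.erase_subset r Pᶜ)
  calc (repairClauses r P).card ≤ (Pᶜ.erase r).card + (Pᶜ.erase r).card :=
        (Finset.card_union_le _ _).trans (Nat.add_le_add Finset.card_image_le Finset.card_image_le)
    _ ≤ 2 * Pᶜ.card := by omega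

/-- If the link of `P` in the permuted system is not strongly connected, then `P` is defective.
The arcs go in both directions, so the complement of a closed set is closed, too, and the smaller
one of the two sets is a witness. -/
lemma defective_of_no_arc {ι : Type*} [Fintype ι] [Nonempty ι] {k : ℕ} {S : Finset (Finset V)}
    (hS : NoIsolated k S) {σ : ι → Perm V} {P : Finset V} (hP : P.card + 1 = k) {p : V → Prop}
    (hy : ∃ y, y ∉ P ∧ p y) (hx : ∃ x, x ∉ P ∧ ¬ p x)
    (hno : ∀ y x, y ∉ P → x ∉ P → p y → ¬ p x →
      (insert x (insert y P), x) ∉ permutedClauses S σ) : Defective S σ P := by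
  classical
  have hno' : ∀ y x i, y ∉ P → x ∉ P → p y → ¬ p x →
      (insert x (insert y P)).map (σ i).toEmbedding ∉ S := by
    intro y x i hy hx hpy hpx h
    exact hno y x hy hx hpy hpx (mem_permutedClauses.2 ⟨by simp, i, h⟩)
  have htwo : ∀ U ⊆ Pᶜ, U.Nonempty → (∀ i, σ i ∈ closingPerms S P U) → 2 ≤ U.card := by
    rintro U hU ⟨x, hx⟩ hc
    obtain ⟨i⟩ := ‹Nonempty ι›
    obtain ⟨w, hw, hwx, hxw⟩ := hS (P.map (σ i).toEmbedding) (by rw [Finset.card_map, hP]) (σ i x)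
      (by simpa using Finset.mem_compl.1 (hU hx))
    obtain ⟨y, rfl⟩ := (σ i).surjective w
    have hyU := (mem_closingPerms hU).1 (hc i) x hx y (by simpa using hw)
      (by simpa [LinkRel, Finset.map_insert] using hxw)
    exact Finset.one_lt_card.2 ⟨x, hx, y, hyU, fun h => hwx (by rw [h])⟩
  let U := Pᶜ.filter p
  let U' := Pᶜ.filter fun v => ¬ p v
  have hUs : U ⊆ Pᶜ := Finset.filter_subset _ _
  have hUs' : U' ⊆ Pᶜ := Finset.filter_subset _ _
  have hc : ∀ i, σ i ∈ closingPerms S P U := by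
    intro i
    refine (mem_closingPerms hUs).2 fun x hx y hy hxy => ?_
    obtain ⟨hxP, hpx⟩ := Finset.mem_filter.1 hx
    refine Finset.mem_filter.2 ⟨Finset.mem_compl.2 hy, ?_⟩
    by_contra hpy
    rw [Finset.insert_comm] at hxy
    exact hno' x y i (Finset.mem_compl.1 hxP) hy hpx hpy hxy
  have hc' : ∀ i, σ i ∈ closingPerms S P U' := by
    intro i
    refine (mem_closingPerms hUs').2 fun x hx y hy hxy => ?_
    obtain ⟨hxP, hpx⟩ := Finset.mem_filter.1 hx
    refine Finset.mem_filter.2 ⟨Finset.mem_compl.2 hy, fun hpy => ?_⟩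
    exact hno' y x i hy (Finset.mem_compl.1 hxP) hpy hpx hxy
  obtain ⟨y, hyP, hpy⟩ := hy
  obtain ⟨x, hxP, hpx⟩ := hx
  have h1 := htwo U hUs ⟨y, Finset.mem_filter.2 ⟨Finset.mem_compl.2 hyP, hpy⟩⟩ hc
  have h2 := htwo U' hUs' ⟨x, Finset.mem_filter.2 ⟨Finset.mem_compl.2 hxP, hpx⟩⟩ hc'
  have hadd : U.card + U'.card = Pᶜ.card := Finset.card_filter_add_card_filter_not p
  rcases le_total U.card U'.card with h | h
  · exact ⟨U, hUs, h1, by omega, hc⟩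
  · exact ⟨U', hUs', h2, by omega, hc'⟩

lemma exists_arc_repairClauses {r : V} {P : Finset V} (hr : r ∉ P) {p : V → Prop}
    (hy : ∃ y, y ∉ P ∧ p y) (hx : ∃ x, x ∉ P ∧ ¬ p x) :
    ∃ y x, y ∉ P ∧ x ∉ P ∧ p y ∧ ¬ p x ∧ (insert x (insert y P), x) ∈ repairClauses r P := by
  obtain ⟨y, hyP, hpy⟩ := hy
  obtain ⟨x, hxP, hpx⟩ := hx
  by_cases hpr : p r
  · have hxr : x ≠ r := by rintro rfl; exact hpx hpr
    exact ⟨r, x, hr, hxP, hpr, hpx, Finset.mem_union_left _ (Finset.mem_image.2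
      ⟨x, Finset.mem_erase.2 ⟨hxr, Finset.mem_compl.2 hxP⟩, rfl⟩)⟩
  · have hyr : y ≠ r := by rintro rfl; exact hpr hpy
    refine ⟨y, r, hyP, hr, hpy, hpr, Finset.mem_union_right _ (Finset.mem_image.2
      ⟨y, Finset.mem_erase.2 ⟨hyr, Finset.mem_compl.2 hyP⟩, ?_⟩)⟩
    rw [Finset.insert_comm]

/-- Four permuted copies of a set system without isolated vertices in its links, together with
the repair clauses for the few defective sets, have strongly connected links. -/
lemma exists_linkConnected_card_le {j : ℕ} {S : Finset (Finset V)}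
    (hS : ∀ B ∈ S, B.card = j + 2) (hiso : NoIsolated (j + 1) S)
    (hm : 10 ≤ Fintype.card V - j) (hm' : 20000 * (j + 1) ≤ (Fintype.card V - j) ^ 2) :
    ∃ H : Finset (Finset V × V), LinkConnected (j + 1) H ∧
      (∀ B x, (B, x) ∈ H → B.card = j + 2 ∧ x ∈ B) ∧
      H.card ≤ 4 * ((j + 2) * S.card) + 2 * (Fintype.card V).choose (j + 1) := by
  classical
  set m := Fintype.card V - j with hmdef
  obtain ⟨σ, hσ⟩ := exists_perms_card_defective_le hiso hm
  rw [← hmdef] at hσ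
  set 𝒟 := (Finset.powersetCard j Finset.univ).filter fun P => Defective S σ P with h𝒟
  have hne : ∀ P : Finset V, ∃ r : V, P.card = j → r ∉ P := by
    intro P
    obtain ⟨v⟩ : Nonempty V := Fintype.card_pos_iff.1 (by omega)
    by_cases hP : P.card = j
    · obtain ⟨r, hr⟩ := Finset.card_pos.1 (show 0 < Pᶜ.card by rw [Finset.card_compl, hP]; omega)
      exact ⟨r, fun _ => Finset.mem_compl.1 hr⟩
    · exact ⟨v, fun h => absurd h hP⟩
  choose r hr using hne
  have h𝒟card : ∀ P ∈ 𝒟, P.card = j := fun P hP =>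
    (Finset.mem_powersetCard.1 (Finset.mem_filter.1 hP).1).2
  refine ⟨permutedClauses S σ ∪ 𝒟.biUnion fun P => repairClauses (r P) P, ?_, ?_, ?_⟩
  · intro P hP p hy hx
    have hPj : P.card = j := Nat.succ_injective hP
    by_cases hd : Defective S σ P
    · obtain ⟨y, x, h1, h2, h3, h4, h5⟩ := exists_arc_repairClauses (hr P hPj) hy hx
      exact ⟨y, x, h1, h2, h3, h4, Finset.mem_union_right _ (Finset.mem_biUnion.2
        ⟨P, Finset.mem_filter.2 ⟨Finset.mem_powersetCard.2 ⟨Finset.subset_univ P, hPj⟩, hd⟩, h5⟩)⟩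
    · by_contra hno
      refine hd (defective_of_no_arc hiso hP hy hx fun y x h1 h2 h3 h4 h5 => ?_)
      exact hno ⟨y, x, h1, h2, h3, h4, Finset.mem_union_left _ h5⟩
  · intro B x h
    rcases Finset.mem_union.1 h with h | h
    · obtain ⟨hx, i, hi⟩ := mem_permutedClauses.1 h
      exact ⟨by simpa using hS _ hi, hx⟩
    · obtain ⟨P, hP, h⟩ := Finset.mem_biUnion.1 h
      have hPj := h𝒟card P hP
      have key : ∀ y ∈ Pᶜ.erase (r P), (insert y (insert (r P) P)).card = j + 2 := by
        intro y hy
        obtain ⟨hy1, hy2⟩ := Finset.mem_erase.1 hy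
        rw [Finset.card_insert_of_notMem, Finset.card_insert_of_notMem (hr P hPj), hPj]
        rw [Finset.mem_insert, not_or]
        exact ⟨hy1, Finset.mem_compl.1 hy2⟩
      rcases Finset.mem_union.1 h with h | h <;> obtain ⟨y, hy, he⟩ := Finset.mem_image.1 h <;>
        obtain ⟨rfl, rfl⟩ := Prod.mk.inj he <;> exact ⟨key y hy, by simp⟩
  · have h1 : (permutedClauses S σ).card ≤ 4 * ((j + 2) * S.card) := by
      have := card_permutedClauses_le (k := j + 1) hS σ
      rwa [Fintype.card_fin] at this
    have h2 : (𝒟.biUnion fun P => repairClauses (r P) P).card ≤ 𝒟.card * (2 * m) := by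
      refine Finset.card_biUnion_le_card_mul _ _ _ fun P hP => ?_
      refine (card_repairClauses_le _ _).trans ?_
      rw [Finset.card_compl, h𝒟card P hP]
    have h3 : 𝒟.card * m ≤ (Fintype.card V).choose (j + 1) := by
      have hm0 : (0 : ℝ) < m := by
        have : 0 < m := by omega
        exact_mod_cast this
      have hj0 : (0 : ℝ) < (j : ℝ) + 1 := by positivity
      have hch : ((Fintype.card V).choose (j + 1) : ℝ) * (j + 1) =
          (Fintype.card V).choose j * m := by
        exact_mod_cast Nat.choose_succ_right_eq (Fintype.card V) j
      have hm2 : (20000 : ℝ) * (j + 1) ≤ (m : ℝ) ^ 2 := by exact_mod_cast hm'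
      have : (𝒟.card : ℝ) * m ≤ (Fintype.card V).choose (j + 1) := by
        rw [eq_div_of_mul_eq hj0.ne' hch]
        calc (𝒟.card : ℝ) * m
            ≤ (Fintype.card V).choose j * (20000 / (m : ℝ) ^ 2) * m := by gcongr
          _ = (Fintype.card V).choose j * (20000 / (m : ℝ)) := by field_simp
          _ ≤ (Fintype.card V).choose j * (m / ((j : ℝ) + 1)) := by
              refine mul_le_mul_of_nonneg_left ?_ (Nat.cast_nonneg _)
              rw [div_le_div_iff₀ hm0 hj0]
              linarith
          _ = _ := by ring
      exact_mod_cast this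
    calc _ ≤ 4 * ((j + 2) * S.card) + 𝒟.card * (2 * m) :=
          (Finset.card_union_le _ _).trans (Nat.add_le_add h1 h2)
      _ ≤ _ := by linarith

end SmallFormula

/-! ### Smallest equivalent formulas and the asymptotics -/

lemma exists_isSmallestEquivalent {V : Type*} [Fintype V] [DecidableEq V] (φ : Formula V) :
    ∃ ψ, IsSmallestEquivalent φ ψ := by
  obtain ⟨ψ, hψ, hmin⟩ := (measure (Finset.card : Formula V → ℕ)).wf.has_min
    {χ | Equivalent φ χ} ⟨φ, fun _ => rfl⟩
  exact ⟨ψ, hψ, fun χ hχ => not_lt.1 (hmin χ hχ)⟩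

lemma not_equivalent_empty {V : Type*} [Fintype V] [DecidableEq V] {H : Finset (Finset V × V)}
    (hH : H.Nonempty) (hH' : ∀ B x, (B, x) ∈ H → x ∈ B) : ¬ Equivalent (hornFormula H) ∅ := by
  obtain ⟨⟨B, x⟩, hBx⟩ := hH
  refine not_equivalent_of_stuck (fun y => if y ∈ B.erase x then some true else none)
    (by simp) (by simp) (l := (x, true)) (by simp) ?_
  refine Derives.step _ (subset_withAssignment _ _ (mem_hornFormula.2 ⟨B, x, hBx, rfl⟩)) _
    (mem_hornClause.2 ⟨hH' B x hBx, by simp⟩) ?_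
  rintro ⟨y, b⟩ hy hne
  obtain ⟨hyB, hb⟩ := mem_hornClause.1 hy
  dsimp only at hyB
  have hyx : y ≠ x := by
    rintro rfl
    exact hne (Prod.ext rfl (hb.trans (decide_eq_true rfl)))
  obtain rfl : b = false := hb.trans (decide_eq_false hyx)
  exact derives_of_assigned _ (by simp [Literal.neg, hyx, hyB])

/-- The size of the star formula, for `k` in the middle half of the range. -/
lemma card_starClauses_bounds {n k : ℕ} (hk : 3 * n ≤ 8 * k) (hk' : 8 * k ≤ 5 * n) (hn : 0 < n) :
    1 / 8 * (n : ℝ) * (n.choose k : ℝ) ≤ (((k + 1) * (n - 1).choose k : ℕ) : ℝ) ∧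
      (((k + 1) * (n - 1).choose k : ℕ) : ℝ) ≤ 1 * (n : ℝ) * (n.choose k : ℝ) := by
  obtain ⟨m, rfl⟩ : ∃ m, n = m + 1 := ⟨n - 1, by omega⟩
  have hid : ((m + 1 : ℕ) : ℝ) * (m.choose k) = ((m + 1).choose k) * (((m + 1 : ℕ) : ℝ) - k) := by
    have h2 := Nat.choose_mul_succ_eq m k
    have hkm : k ≤ m + 1 := by omega
    rw [← Nat.cast_sub hkm]
    rw [mul_comm] at h2
    exact_mod_cast h2
  set n := ((m + 1 : ℕ) : ℝ) with hn
  have hn0 : (0 : ℝ) < n := by positivity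
  have h1 : 3 * n ≤ 8 * (k : ℝ) := by rw [hn]; exact_mod_cast hk
  have h2 : 8 * (k : ℝ) ≤ 5 * n := by rw [hn]; exact_mod_cast hk'
  have hk1 : (k : ℝ) + 1 ≤ n := by
    have : k + 1 ≤ m + 1 := by omega
    rw [hn]
    exact_mod_cast this
  have hC : (0 : ℝ) ≤ (m + 1).choose k := Nat.cast_nonneg _
  have hval : (((k + 1) * (m + 1 - 1).choose k : ℕ) : ℝ) =
      ((m + 1).choose k) * ((k + 1) * (n - k) / n) := by
    rw [Nat.add_sub_cancel, ← mul_div_assoc, eq_div_iff hn0.ne']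
    push_cast
    linear_combination ((k : ℝ) + 1) * hid
  rw [hval]
  constructor
  · rw [mul_comm]
    refine mul_le_mul_of_nonneg_left ?_ hC
    rw [le_div_iff₀ hn0]
    nlinarith
  · rw [mul_comm]
    refine mul_le_mul_of_nonneg_right ?_ hC
    rw [div_le_iff₀ hn0]
    nlinarith

end UCP

theorem theorem1 :
    ∃ a b d e : ℝ, 0 < a ∧ 0 < b ∧ 0 < d ∧ 0 < e ∧
      ∀ c : ℝ, ∃ N : ℕ, ∀ n k : ℕ, N ≤ n → |(k : ℝ) - (n : ℝ) / 2| ≤ c →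
        ∃ φl φs : UCP.Formula (Fin n),
          UCP.Irredundant φl ∧
          φl.card = (k + 1) * (n - 1).choose k ∧
          a * (n : ℝ) * (n.choose k : ℝ) ≤ (((k + 1) * (n - 1).choose k : ℕ) : ℝ) ∧
          (((k + 1) * (n - 1).choose k : ℕ) : ℝ) ≤ b * (n : ℝ) * (n.choose k : ℝ) ∧
          UCP.IsSmallestEquivalent φl φs ∧
          φs.card ≤ 6 * (k + 1) * UCP.coveringNumber n (k + 1) k ∧
          ((6 * (k + 1) * UCP.coveringNumber n (k + 1) k : ℕ) : ℝ) ≤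
            d * Real.log (n : ℝ) * (n.choose k : ℝ) ∧
          e * ((n : ℝ) / Real.log (n : ℝ)) ≤ (φl.card : ℝ) / (φs.card : ℝ) := by
  refine ⟨1 / 8, 1, 18, 1 / 144, by norm_num, by norm_num, by norm_num, by norm_num, fun c =>
    ⟨⌈8 * c⌉₊ + 100000, fun n k hn hk => ?_⟩⟩
  -- The bound `8 * c ≤ n` puts `k` between `3 n / 8` and `5 n / 8`, and `100000 ≤ n` makes the
  -- number of defective sets small enough.
  have hnbig : 100000 ≤ n := by omega
  have hc : 8 * c ≤ n := (Nat.le_ceil _).trans (by exact_mod_cast (by omega : ⌈8 * c⌉₊ ≤ n))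
  obtain ⟨hk1, hk2⟩ := abs_le.1 hk
  have hkl : 3 * n ≤ 8 * k := by
    have : (3 : ℝ) * n ≤ 8 * k := by linarith
    exact_mod_cast this
  have hku : 8 * k ≤ 5 * n := by
    have : (8 : ℝ) * k ≤ 5 * n := by linarith
    exact_mod_cast this
  obtain ⟨j, rfl⟩ : ∃ j, k = j + 1 := ⟨k - 1, by omega⟩
  have hkn : j + 1 < n := by omega
  obtain ⟨ha, hb⟩ := UCP.card_starClauses_bounds hkl hku (by omega)
  let z : Fin n := ⟨0, by omega⟩
  have hstar : ∀ B x, (B, x) ∈ UCP.starClauses z (j + 1) → B.card = j + 2 ∧ x ∈ B := fun B x h =>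
    ⟨(UCP.mem_starClauses.1 h).1, (UCP.mem_starClauses.1 h).2.2⟩
  have hcard : (UCP.hornFormula (UCP.starClauses z (j + 1))).card =
      (j + 1 + 1) * (n - 1).choose (j + 1) := by
    rw [UCP.card_hornFormula fun B x h => (hstar B x h).2, UCP.card_starClauses, Fintype.card_fin]
  obtain ⟨φs, hφs⟩ := UCP.exists_isSmallestEquivalent (UCP.hornFormula (UCP.starClauses z (j + 1)))
  obtain ⟨S, hS, hScard⟩ := UCP.exists_isCovering_card_eq hkn
  have hsmall : φs.card ≤ 6 * (j + 1 + 1) * UCP.coveringNumber n (j + 1 + 1) (j + 1) := by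
    obtain ⟨H, hH, hH', hHcard⟩ := UCP.exists_linkConnected_card_le hS.1 hS.noIsolated
      (by rw [Fintype.card_fin]; omega)
      (by
        rw [Fintype.card_fin]
        have h1 : 3 * n ≤ 8 * (n - j) := by omega
        nlinarith)
    rw [Fintype.card_fin] at hHcard
    have h1 := hφs.2 _ ((UCP.linkConnected_starClauses z (j + 1)).equivalent (Nat.succ_pos j)
      hstar hH hH')
    rw [UCP.card_hornFormula fun B x h => (hH' B x h).2] at h1
    have h2 := hS.choose_le
    rw [← hScard]
    linarith
  have hlogn : 1 ≤ Real.log n := by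
    rw [Real.le_log_iff_exp_le (by positivity)]
    have h3 : (100000 : ℝ) ≤ n := by exact_mod_cast hnbig
    linarith [Real.exp_one_lt_d9]
  have hchoose : n ≤ n.choose (j + 1) := by
    calc n = n.choose 1 := (Nat.choose_one_right n).symm
      _ ≤ n.choose (j + 1) := by
        rcases le_total (2 * (j + 1)) n with h | h
        · exact UCP.choose_le_choose_of_le_half (by omega) h
        · rw [← Nat.choose_symm hkn.le]
          exact UCP.choose_le_choose_of_le_half (by omega) (by omega)
  have hC : (0 : ℝ) < n.choose (j + 1) := by
    have : 0 < n.choose (j + 1) := by omega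
    exact_mod_cast this
  have hcover : ((6 * (j + 1 + 1) * UCP.coveringNumber n (j + 1 + 1) (j + 1) : ℕ) : ℝ) ≤
      18 * Real.log n * n.choose (j + 1) := by
    have h1 := UCP.coveringNumber_le hkn
    have hjn : ((j + 1 : ℕ) : ℝ) + 1 ≤ n := by exact_mod_cast (by omega : j + 1 + 1 ≤ n)
    have h2 : Real.log (((j + 1 : ℕ) : ℝ) + 1) ≤ Real.log n :=
      Real.log_le_log (by positivity) hjn
    have h3 : (n : ℝ) ≤ n.choose (j + 1) := by exact_mod_cast hchoose
    have h4 := mul_le_mul_of_nonneg_left h2 hC.le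
    have h5 := mul_le_mul_of_nonneg_left hlogn hC.le
    push_cast at *
    linarith
  refine ⟨_, φs, UCP.irredundant_starClauses z (j + 1), hcard, ha, hb, hφs, hsmall, hcover, ?_⟩
  -- A smallest equivalent formula is not empty, so the quotient of the sizes is a proper one.
  have hpos : (0 : ℝ) < φs.card := by
    rw [Nat.cast_pos, Finset.card_pos, Finset.nonempty_iff_ne_empty]
    rintro rfl
    refine UCP.not_equivalent_empty ?_ (fun B x h => (hstar B x h).2) hφs.1
    rw [← Finset.card_pos, UCP.card_starClauses, Fintype.card_fin]
    exact Nat.mul_pos (Nat.succ_pos _) (Nat.choose_pos (by omega))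
  have hle : (φs.card : ℝ) ≤ 18 * Real.log n * n.choose (j + 1) :=
    le_trans (by exact_mod_cast hsmall) hcover
  rw [hcard, le_div_iff₀ hpos]
  have hlog0 : 0 < Real.log n := by linarith
  calc 1 / 144 * ((n : ℝ) / Real.log n) * φs.card
      ≤ 1 / 144 * ((n : ℝ) / Real.log n) * (18 * Real.log n * n.choose (j + 1)) := by gcongr
    _ = 1 / 8 * n * n.choose (j + 1) := by field_simp; norm_num
    _ ≤ _ := ha
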